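/- Let $\mathfrak g$ be a Lie algebra over $\mathbb C$ of countable (possibly finite) dimension, equipped with a nondegenerate symmetric invariant bilinear form $\langle\cdot,\cdot\rangle$. Let $\hat{\mathfrak g}=\mathfrak g\otimes\mathbb C[t,t^{-1}]\oplus\mathbb C\mathbf c$ be the affine Lie algebra, in which $\mathbf c$ is central and $$[a\otimes t^m,\,b\otimes t^n]=[a,b]\otimes t^{m+n}+m\langle a,b\rangle\delta_{m+n,0}\,\mathbf c\qquad(a,b\in\mathfrak g,\ m,n\in\mathbb Z).$$ For $\ell\in\mathbb C$ let $V_{\hat{\mathfrak g}}(\ell,0)=U(\hat{\mathfrak g})\otimes_{U(\mathfrak g\otimes\mathbb C[t]\oplus\mathbb C\mathbf c)}\mathbb C_\ell$, where $\mathbb C_\ell=\mathbb C$ with $\mathfrak g\otimes\mathbb C[t]$ acting by $0$ and $\mathbf c$ by $\ell$. Write $a(n)$ for the action of $a\otimes t^n$, $a(x)=\sum_{n\in\mathbb Z}a(n)x^{-n-1}$, and $\mathbf 1=1\otimes 1$. Then $V_{\hat{\mathfrak g}}(\ell,0)$ is a vertex algebra with vacuum $\mathbf 1$, whose vertex operator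 map is the linear map $Y(\cdot,x):V_{\hat{\mathfrak g}}(\ell,0)\to\mathrm{Hom}\big(V_{\hat{\mathfrak g}}(\ell,0),V_{\hat{\mathfrak g}}(\ell,0)((x))\big)$ determined by $Y(\mathbf 1,x)=1$ and $$Y(a(n)v,x)=\mathrm{Res}_{x_1}\big((x_1-x)^n a(x_1)Y(v,x)-(-x+x_1)^n Y(v,x)a(x_1)\big)\qquad(a\in\mathfrak g,\ n\in\mathbb Z),$$ where $(x_1-x)^n$ is expanded in nonnegative powers of $x$ and $(-x+x_1)^n$ in nonnegative powers of $x_1$; in particular $Y(a(-1)\mathbf 1,x)=a(x)$. A vertex algebra $V$ is called nondegenerate if for every positive integer $n$ the linear map $$Z_n:V^{\otimes n}\otimes\mathbb C((x_1))\cdots((x_n))\to V((x_1))\cdots((x_n)),\qquad Z_n(u_1\otimes\cdots\otimes u_n\otimes f)=f\,Y(u_1,x_1)\cdots Y(u_n,x_n)\mathbf 1,$$ is injective. Then for every complex number $\ell$ the vertex algebra $V_{\hat{\mathfrak g}}(\ell,0)$ is nondegenerate. -/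

import Mathlib

namespace AffineVA

noncomputable section

open scoped TensorProduct

section Fields

variable {V : Type*} [AddCommGroup V] [Module ℂ V]

/-- The mode `φ_m ∈ End V` of the vertex operator `φ(x) = ∑ φ_m x^(-m-1)`. -/
def mode (φ : VertexOperator ℂ V) (m : ℤ) : Module.End ℂ V := VertexOperator.ncoeff φ m

theorem mode_add (φ ψ : VertexOperator ℂ V) (m : ℤ) (w : V) :
    mode (φ + ψ) m w = mode φ m w + mode ψ m w := by
  simp [mode]

theorem mode_sub (φ ψ : VertexOperator ℂ V) (m : ℤ) (w : V) :
    mode (φ - ψ) m w = mode φ m w - mode ψ m w := by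
  simp [mode]

theorem mode_smul (c : ℂ) (φ : VertexOperator ℂ V) (m : ℤ) (w : V) :
    mode (c • φ) m w = c • mode φ m w := by
  simp [mode]

/-- Every vertex operator `φ(x) = ∑ φ_m x^(-m-1)` satisfies `φ_m w = 0` for large `m`. -/
theorem ncoeff_trunc (φ : VertexOperator ℂ V) (w : V) :
    ∃ N : ℤ, ∀ m, N ≤ m → mode φ m w = 0 := by
  refine ⟨-HahnSeries.order ((HahnModule.of ℂ).symm (φ w)), fun m hm => ?_⟩
  exact VertexOperator.ncoeff_eq_zero_of_lt_order φ m w (by omega)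

theorem vo_ext {φ ψ : VertexOperator ℂ V} (h : ∀ m w, mode φ m w = mode ψ m w) : φ = ψ := by
  refine HVertexOperator.coeff_inj (funext fun k => LinearMap.ext fun w => ?_)
  rw [VertexOperator.coeff_eq_ncoeff, VertexOperator.coeff_eq_ncoeff]
  exact h _ _

theorem finsum_eq_range {M : Type*} [AddCommGroup M] (f : ℕ → M) (N : ℕ)
    (h : ∀ i, N ≤ i → f i = 0) : ∑ᶠ i, f i = ∑ i ∈ Finset.range N, f i := by
  apply finsum_eq_sum_of_support_subset
  intro i hi
  by_contra hc
  exact hi (h i (by simpa using hc))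

/-- The coefficients `(-1)^i (n choose i)` of `(x₁ - x)^n` expanded in nonnegative powers of `x`. -/
def bp (n : ℤ) (i : ℕ) : ℂ := (-1) ^ i * (Ring.choose n i : ℤ)

/-- The coefficients `(-1)^(n+i) (n choose i)` of `(-x + x₁)^n` expanded in nonnegative powers
of `x₁`. -/
def bq (n : ℤ) (i : ℕ) : ℂ := (-1) ^ (n + i) * (Ring.choose n i : ℤ)

/-- The `m`-th mode, applied to the vector `w`, of the `n`-th product
`α(x)_n φ(x) = Res_{x₁} ((x₁ - x)^n α(x₁) φ(x) - (-x + x₁)^n φ(x) α(x₁))`, that is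
`∑_{i ≥ 0} (-1)^i (n choose i) (α_{n-i} φ_{m+i} w - (-1)^n φ_{m+n-i} α_i w)`.
Both sums have only finitely many nonzero terms. -/
def nthMode (n : ℤ) (α φ : VertexOperator ℂ V) (m : ℤ) (w : V) : V :=
  (∑ᶠ i : ℕ, bp n i • (mode α (n - i)) ((mode φ (m + i)) w)) -
    ∑ᶠ i : ℕ, bq n i • (mode φ (m + n - i)) ((mode α ((i : ℤ))) w)

theorem nthMode_eventually_aux (n : ℤ) (α φ : VertexOperator ℂ V) (w : V) :
    ∃ N₀ : ℕ, ∀ m : ℤ, ∀ N : ℕ, N₀ ≤ N → N₀ - m ≤ N → nthMode n α φ m w =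
      (∑ i ∈ Finset.range N, bp n i • (mode α (n - i)) ((mode φ (m + i)) w)) -
      ∑ i ∈ Finset.range N, bq n i • (mode φ (m + n - i)) ((mode α ((i : ℤ))) w) := by
  obtain ⟨N₁, h₁⟩ := ncoeff_trunc φ w
  obtain ⟨N₂, h₂⟩ := ncoeff_trunc α w
  refine ⟨N₁.toNat + N₂.toNat, fun m N hN hN' => ?_⟩
  rw [nthMode, finsum_eq_range _ N fun i hi => ?_, finsum_eq_range _ N fun i hi => ?_]
  · rw [h₂ _ (by omega), map_zero, smul_zero]
  · rw [h₁ _ (by omega), map_zero, smul_zero]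

theorem nthMode_eventually (n : ℤ) (α φ : VertexOperator ℂ V) (m : ℤ) (w : V) :
    ∀ᶠ N : ℕ in Filter.atTop, nthMode n α φ m w =
      (∑ i ∈ Finset.range N, bp n i • (mode α (n - i)) ((mode φ (m + i)) w)) -
      ∑ i ∈ Finset.range N, bq n i • (mode φ (m + n - i)) ((mode α ((i : ℤ))) w) := by
  obtain ⟨N₀, h⟩ := nthMode_eventually_aux n α φ w
  filter_upwards [Filter.eventually_ge_atTop (N₀ + (N₀ - m).toNat)] with N hN
  exact h m N (by omega) (by omega)

theorem nthMode_trunc (n : ℤ) (α φ : VertexOperator ℂ V) (w : V) :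
    ∃ L : ℤ, ∀ m, L ≤ m → nthMode n α φ m w = 0 := by
  obtain ⟨N₁, h₁⟩ := ncoeff_trunc φ w
  obtain ⟨N₂, h₂⟩ := ncoeff_trunc α w
  choose L hL using fun i : ℕ => ncoeff_trunc φ ((mode α ((i : ℤ))) w)
  obtain ⟨L₀, hL₀⟩ : ∃ L₀ : ℤ, ∀ i < N₂.toNat, L i - n + i ≤ L₀ := by
    obtain ⟨b, hb⟩ := ((Finset.range N₂.toNat).image fun i : ℕ => L i - n + i).bddAbove
    exact ⟨b, fun i hi => hb (by
      simp only [Finset.coe_image, Set.mem_image, Finset.mem_coe, Finset.mem_range]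
      exact ⟨i, hi, rfl⟩)⟩
  refine ⟨max N₁ L₀, fun m hm => ?_⟩
  rw [max_le_iff] at hm
  have e₁ : ∀ i : ℕ, bp n i • (mode α (n - i)) ((mode φ (m + i)) w) = 0 := fun i => by
    rw [h₁ _ (by omega), map_zero, smul_zero]
  have e₂ : ∀ i : ℕ, bq n i • (mode φ (m + n - i)) ((mode α ((i : ℤ))) w) = 0 := fun i => by
    by_cases hi : i < N₂.toNat
    · rw [hL i _ (by have := hL₀ i hi; omega), smul_zero]
    · rw [h₂ i (by omega), map_zero, smul_zero]
  simp only [nthMode, e₁, e₂, finsum_zero, sub_zero]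

/-- The `n`-th product `α(x)_n φ(x)` of two vertex operators. -/
def nthProd (n : ℤ) (α φ : VertexOperator ℂ V) : VertexOperator ℂ V :=
  VertexOperator.of_coeff
    (fun k =>
      { toFun := nthMode n α φ (-k - 1)
        map_add' := fun v w => by
          obtain ⟨N, h₁, h₂, h₃⟩ := ((nthMode_eventually n α φ (-k - 1) v).and
            ((nthMode_eventually n α φ (-k - 1) w).and
              (nthMode_eventually n α φ (-k - 1) (v + w)))).exists
          rw [h₁, h₂, h₃]
          simp only [map_add, smul_add, Finset.sum_add_distrib]
          abel
        map_smul' := fun c v => by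
          obtain ⟨N, h₁, h₃⟩ := ((nthMode_eventually n α φ (-k - 1) v).and
            (nthMode_eventually n α φ (-k - 1) (c • v))).exists
          rw [h₁, h₃]
          simp only [map_smul, smul_sub, Finset.smul_sum, RingHom.id_apply, smul_comm c] })
    (fun w => by
      obtain ⟨L, hL⟩ := nthMode_trunc n α φ w
      refine ⟨-L, fun k hk => ?_⟩
      by_contra hc
      exact hk (hL _ (by omega)))

theorem ncoeff_nthProd (n : ℤ) (α φ : VertexOperator ℂ V) (m : ℤ) (w : V) :
    (mode (nthProd n α φ) m) w = nthMode n α φ m w := by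
  change nthMode n α φ (-(-m - 1) - 1) w = _
  rw [show -(-m - 1) - 1 = m by ring]

/-- The `n`-th product of vertex operators as a bilinear map. -/
def nthProduct (n : ℤ) :
    VertexOperator ℂ V →ₗ[ℂ] VertexOperator ℂ V →ₗ[ℂ] VertexOperator ℂ V :=
  LinearMap.mk₂ ℂ (nthProd n)
    (fun α β φ => by
      refine vo_ext fun m w => ?_
      obtain ⟨N, h₁, h₂, h₃⟩ := ((nthMode_eventually n α φ m w).and
        ((nthMode_eventually n β φ m w).and (nthMode_eventually n (α + β) φ m w))).exists
      simp only [mode_add, map_add, ncoeff_nthProd] at h₁ h₂ h₃ ⊢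
      rw [h₁, h₂, h₃]
      simp only [smul_add, Finset.sum_add_distrib]
      abel)
    (fun c α φ => by
      refine vo_ext fun m w => ?_
      obtain ⟨N, h₁, h₃⟩ := ((nthMode_eventually n α φ m w).and
        (nthMode_eventually n (c • α) φ m w)).exists
      simp only [mode_smul, map_smul, ncoeff_nthProd] at h₁ h₃ ⊢
      rw [h₁, h₃]
      simp only [smul_sub, Finset.smul_sum, smul_comm c])
    (fun α φ ψ => by
      refine vo_ext fun m w => ?_
      obtain ⟨N, h₁, h₂, h₃⟩ := ((nthMode_eventually n α φ m w).and
        ((nthMode_eventually n α ψ m w).and (nthMode_eventually n α (φ + ψ) m w))).exists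
      simp only [mode_add, map_add, ncoeff_nthProd] at h₁ h₂ h₃ ⊢
      rw [h₁, h₂, h₃]
      simp only [smul_add, Finset.sum_add_distrib]
      abel)
    (fun c α φ => by
      refine vo_ext fun m w => ?_
      obtain ⟨N, h₁, h₃⟩ := ((nthMode_eventually n α φ m w).and
        (nthMode_eventually n α (c • φ) m w)).exists
      simp only [mode_smul, map_smul, ncoeff_nthProd] at h₁ h₃ ⊢
      rw [h₁, h₃]
      simp only [smul_sub, Finset.smul_sum, smul_comm c])

theorem ncoeff_nthProduct (n : ℤ) (α φ : VertexOperator ℂ V) (m : ℤ) (w : V) :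
    (mode (nthProduct n α φ) m) w = nthMode n α φ m w := ncoeff_nthProd n α φ m w

/-- The vertex operator equal to the identity of `V`. -/
def idField : VertexOperator ℂ V :=
  VertexOperator.of_coeff (fun k => if k = 0 then 1 else 0) (fun w => ⟨0, fun k hk => by
    by_contra hc
    exact hk (by simp [show k ≠ 0 by omega])⟩)

theorem ncoeff_idField (m : ℤ) (w : V) :
    (mode (idField (V := V)) m) w = if m = -1 then w else 0 := by
  have : (mode (idField (V := V)) m) = if -m - 1 = 0 then 1 else 0 := rfl
  rw [this]
  by_cases h : m = -1
  · simp [h]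
  · rw [if_neg h, if_neg (by omega)]; rfl

/-! Combinatorics of the expansion coefficients -/

theorem box_sum {M : Type*} [AddCommGroup M] [Module ℂ M] (c : ℕ → ℕ → ℂ) (h : ℕ → M) (N : ℕ)
    (hN : ∀ s, N ≤ s → h s = 0) :
    ∑ i ∈ Finset.range N, ∑ j ∈ Finset.range N, c i j • h (i + j) =
      ∑ s ∈ Finset.range N, (∑ x ∈ Finset.HasAntidiagonal.antidiagonal s, c x.1 x.2) • h s := by
  rw [← Finset.sum_product']
  rw [← Finset.sum_filter_add_sum_filter_not _ (fun x : ℕ × ℕ => x.1 + x.2 < N)]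
  rw [Finset.sum_eq_zero (s := Finset.filter (fun x : ℕ × ℕ => ¬ x.1 + x.2 < N) _) (by
    intro x hx
    rw [hN _ (by simpa using (Finset.mem_filter.1 hx).2), smul_zero]), add_zero]
  rw [← Finset.sum_fiberwise_of_maps_to (t := Finset.range N) (g := fun x : ℕ × ℕ => x.1 + x.2)
    (by intro x hx; simpa using (Finset.mem_filter.1 hx).2)]
  refine Finset.sum_congr rfl fun s hs => ?_
  rw [Finset.sum_smul]
  refine Finset.sum_congr ?_ ?_
  · ext ⟨a, b⟩
    simp only [Finset.mem_filter, Finset.mem_product, Finset.mem_range,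
      Finset.HasAntidiagonal.mem_antidiagonal] at hs ⊢
    omega
  · intro x hx
    rw [Finset.HasAntidiagonal.mem_antidiagonal.1 hx]

theorem bp_conv (m n : ℤ) (s : ℕ) :
    ∑ x ∈ Finset.HasAntidiagonal.antidiagonal s, bp m x.1 * bp n x.2 = bp (m + n) s := by
  rw [bp, Ring.add_choose_eq s (Commute.all m n)]
  push_cast
  rw [Finset.mul_sum]
  refine Finset.sum_congr rfl fun x hx => ?_
  rw [bp, bp, ← Finset.HasAntidiagonal.mem_antidiagonal.1 hx, pow_add]
  ring

theorem bq_eq (n : ℤ) (i : ℕ) : bq n i = (-1) ^ n * bp n i := by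
  rw [bq, bp, zpow_add₀ (by norm_num), zpow_natCast, mul_assoc]

theorem bq_conv (m n : ℤ) (s : ℕ) :
    ∑ x ∈ Finset.HasAntidiagonal.antidiagonal s, bq m x.1 * bq n x.2 = bq (m + n) s := by
  rw [bq_eq, ← bp_conv, Finset.mul_sum, zpow_add₀ (by norm_num)]
  refine Finset.sum_congr rfl fun x hx => ?_
  rw [bq_eq, bq_eq]
  ring

theorem sub_mul_bp (m : ℤ) (i : ℕ) : ((m : ℂ) - i) * bp m i = m * bp (m - 1) i := by
  have h := Ring.choose_add_smul_choose (m - 1) i 1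
  have key : (m - i) * Ring.choose m i = m * Ring.choose (m - 1) i := by
    have h2 := Ring.choose_smul_choose m (n := i + 1) (k := i) (by omega)
    have h1 := Ring.choose_smul_choose m (n := i + 1) (k := 1) (by omega)
    simp at h1 h2
    linarith
  have key' := congrArg (fun z : ℤ => (z : ℂ)) key
  push_cast at key'
  rw [bp, bp, mul_left_comm, key']
  ring

theorem bp_self_sub_one (s : ℕ) : bp ((s : ℤ) - 1) s = if s = 0 then 1 else 0 := by
  rcases s with _ | s
  · simp [bp]
  · have : (((s + 1 : ℕ) : ℤ) - 1) = ((s : ℕ) : ℤ) := by push_cast; ring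
    rw [bp, this, Ring.choose_natCast]
    simp

/-- If the modes of `α`, `β`, `γ` satisfy affine commutation relations, then so do the operators
of `n`-th product with `α`, `β`, `γ`, on all vertex operators. -/
theorem nthProduct_comm (α β γ : VertexOperator ℂ V) (κ : ℂ)
    (hαβ : ∀ (m n : ℤ) (w : V), (mode α (m)) ((mode β (n)) w) - (mode β (n)) ((mode α (m)) w) =
      (mode γ (m + n)) w + (if m + n = 0 then (m : ℂ) * κ else 0) • w)
    (m n : ℤ) (φ : VertexOperator ℂ V) :
    nthProduct m α (nthProduct n β φ) - nthProduct n β (nthProduct m α φ) =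
      nthProduct (m + n) γ φ + (if m + n = 0 then (m : ℂ) * κ else 0) • φ := by
  -- expansion of an iterated product as a finite double sum
  have expand : ∀ (m n : ℤ) (α β : VertexOperator ℂ V) (k : ℤ) (w : V),
      ∀ᶠ N : ℕ in Filter.atTop, (mode (nthProduct m α (nthProduct n β φ)) k) w =
        ((∑ i ∈ Finset.range N, ∑ j ∈ Finset.range N, (bp m i * bp n j) •
          (mode α (m - i)) ((mode β (n - j)) ((mode φ (k + i + j)) w))) -
        ∑ i ∈ Finset.range N, ∑ j ∈ Finset.range N, (bp m i * bq n j) •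
          (mode α (m - i)) ((mode φ (k + i + n - j)) ((mode β ((j : ℤ))) w))) -
        ((∑ i ∈ Finset.range N, ∑ j ∈ Finset.range N, (bq m i * bp n j) •
          (mode β (n - j)) ((mode φ (k + m - i + j)) ((mode α ((i : ℤ))) w))) -
        ∑ i ∈ Finset.range N, ∑ j ∈ Finset.range N, (bq m i * bq n j) •
          (mode φ (k + m - i + n - j)) ((mode β ((j : ℤ))) ((mode α ((i : ℤ))) w))) := by
    intro m n α β k w
    obtain ⟨N₀, h₀⟩ := nthMode_eventually_aux n β φ w
    obtain ⟨N₁, h₁⟩ := ncoeff_trunc α w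
    have hfin : ∀ᶠ N : ℕ in Filter.atTop, ∀ i ∈ Finset.range N₁.toNat,
        nthMode n β φ (k + m - i) ((mode α ((i : ℤ))) w) =
        (∑ j ∈ Finset.range N, bp n j •
          (mode β (n - j)) ((mode φ (k + m - i + j)) ((mode α ((i : ℤ))) w))) -
        ∑ j ∈ Finset.range N, bq n j •
          (mode φ (k + m - i + n - j)) ((mode β ((j : ℤ))) ((mode α ((i : ℤ))) w)) := by
      rw [Filter.eventually_all_finset]
      intro i _
      exact nthMode_eventually n β φ _ _
    filter_upwards [nthMode_eventually m α (nthProduct n β φ) k w, hfin,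
      Filter.eventually_ge_atTop (N₀ + (N₀ - k).toNat)] with N h hf hN
    rw [ncoeff_nthProduct, h]
    congr 1
    · rw [← Finset.sum_sub_distrib]
      refine Finset.sum_congr rfl fun i hi => ?_
      rw [ncoeff_nthProduct, h₀ (k + i) N (by omega) (by omega), map_sub, smul_sub, map_sum,
        map_sum, Finset.smul_sum, Finset.smul_sum]
      simp only [map_smul, smul_smul]
    · rw [← Finset.sum_sub_distrib]
      refine Finset.sum_congr rfl fun i hi => ?_
      rw [ncoeff_nthProduct]
      by_cases hi' : i < N₁.toNat
      · rw [hf i (Finset.mem_range.2 hi'), smul_sub, Finset.smul_sum, Finset.smul_sum]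
        simp only [smul_smul]
      · rw [h₁ _ (by omega)]
        simp [nthMode]
  refine vo_ext fun k w => ?_
  obtain ⟨K₀, hK₀⟩ := ncoeff_trunc φ w
  obtain ⟨K₁, hK₁⟩ := ncoeff_trunc γ w
  obtain ⟨N, e₁, e₂, e₃, hNK₀, hNK₁, hNmn⟩ := ((expand m n α β k w).and
    ((expand n m β α k w).and ((nthMode_eventually (m + n) γ φ k w).and
    ((Filter.eventually_ge_atTop (K₀ - k).toNat).and
    ((Filter.eventually_ge_atTop K₁.toNat).and
      (Filter.eventually_gt_atTop (m + n).toNat)))))).exists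
  rw [mode_sub, mode_add, mode_smul, e₁, e₂, ncoeff_nthProduct, e₃]
  -- first sums
  have s₁ : (∑ i ∈ Finset.range N, ∑ j ∈ Finset.range N, (bp m i * bp n j) •
          (mode α (m - i)) ((mode β (n - j)) ((mode φ (k + i + j)) w))) -
      (∑ i ∈ Finset.range N, ∑ j ∈ Finset.range N, (bp n i * bp m j) •
          (mode β (n - i)) ((mode α (m - j)) ((mode φ (k + i + j)) w))) =
      (∑ i ∈ Finset.range N, bp (m + n) i • (mode γ (m + n - i)) ((mode φ (k + i)) w)) +
        (if m + n = 0 then (m : ℂ) * κ else 0) • (mode φ (k)) w := by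
    rw [Finset.sum_comm (f := fun i j : ℕ => (bp n i * bp m j) •
          (mode β (n - i)) ((mode α (m - j)) ((mode φ (k + i + j)) w))), ← Finset.sum_sub_distrib]
    simp_rw [← Finset.sum_sub_distrib]
    have : ∀ i j : ℕ, (bp m i * bp n j) • (mode α (m - i)) ((mode β (n - j)) ((mode φ (k + i + j)) w)) -
        (bp n j * bp m i) • (mode β (n - j)) ((mode α (m - i)) ((mode φ (k + j + i)) w)) =
        (bp m i * bp n j) • (mode γ (m + n - (i + j : ℕ))) ((mode φ (k + (i + j : ℕ))) w) +
        (κ * m * (bp (m - 1) i * bp n j)) •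
          (if m + n = (i + j : ℕ) then (mode φ (k + (i + j : ℕ))) w else 0) := by
      intro i j
      rw [mul_comm (bp n j), add_right_comm k (j : ℤ), ← smul_sub, hαβ]
      have h1 : m - i + (n - j) = m + n - (i + j : ℕ) := by push_cast; ring
      have h2 : k + i + j = k + (i + j : ℕ) := by push_cast; ring
      rw [h1, h2, smul_add]
      congr 1
      by_cases h3 : m + n = (i + j : ℕ)
      · rw [if_pos (by omega), if_pos h3, smul_smul]
        congr 1
        have := sub_mul_bp m i
        push_cast
        linear_combination (bp n j * κ) * this
      · rw [if_neg (by omega), if_neg h3]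
        simp
    simp_rw [this, Finset.sum_add_distrib]
    rw [box_sum (fun i j => bp m i * bp n j)
      (fun s => (mode γ (m + n - (s : ℕ))) ((mode φ (k + (s : ℕ))) w)) N
      (fun s hs => by rw [hK₀ _ (by omega), map_zero])]
    rw [box_sum (fun i j => κ * m * (bp (m - 1) i * bp n j))
      (fun s => if m + n = (s : ℕ) then (mode φ (k + (s : ℕ))) w else 0) N
      (fun s hs => by rw [if_neg (by omega)])]
    simp_rw [bp_conv, ← Finset.mul_sum, bp_conv]
    congr 1
    by_cases hmn : ∃ t : ℕ, m + n = t
    · obtain ⟨t, ht⟩ := hmn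
      rw [Finset.sum_eq_single t]
      · rw [if_pos ht, show m - 1 + n = (t : ℤ) - 1 by omega, bp_self_sub_one]
        rcases t with _ | t
        · simp [ht, mul_comm]
        · rw [if_neg (by omega), if_neg (by omega)]; simp
      · intro b _ hb
        rw [if_neg (by omega), smul_zero]
      · intro h
        exact absurd (Finset.mem_range.2 (by omega)) h
    · rw [if_neg (fun h => hmn ⟨0, by simpa using h⟩), zero_smul]
      refine Finset.sum_eq_zero fun s _ => ?_
      rw [if_neg (fun h => hmn ⟨s, h⟩), smul_zero]
  have s₂ : (∑ i ∈ Finset.range N, ∑ j ∈ Finset.range N, (bq m i * bq n j) •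
          (mode φ (k + m - i + n - j)) ((mode β ((j : ℤ))) ((mode α ((i : ℤ))) w))) -
      (∑ i ∈ Finset.range N, ∑ j ∈ Finset.range N, (bq n i * bq m j) •
          (mode φ (k + n - i + m - j)) ((mode α ((j : ℤ))) ((mode β ((i : ℤ))) w))) =
      -∑ i ∈ Finset.range N, bq (m + n) i • (mode φ (k + (m + n) - i)) ((mode γ ((i : ℤ))) w) := by
    rw [Finset.sum_comm (f := fun i j : ℕ => (bq n i * bq m j) •
          (mode φ (k + n - i + m - j)) ((mode α ((j : ℤ))) ((mode β ((i : ℤ))) w))),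
      ← Finset.sum_sub_distrib]
    simp_rw [← Finset.sum_sub_distrib]
    have : ∀ i j : ℕ, (bq m i * bq n j) •
          (mode φ (k + m - i + n - j)) ((mode β ((j : ℤ))) ((mode α ((i : ℤ))) w)) -
        (bq n j * bq m i) • (mode φ (k + n - j + m - i)) ((mode α ((i : ℤ))) ((mode β ((j : ℤ))) w)) =
        -((bq m i * bq n j) •
          (mode φ (k + (m + n) - (i + j : ℕ))) ((mode γ (((i + j : ℕ) : ℤ))) w)) := by
      intro i j
      rw [mul_comm (bq n j), show k + m - i + n - j = k + (m + n) - (i + j : ℕ) by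
        push_cast; ring, show k + n - j + m - i = k + (m + n) - (i + j : ℕ) by
        push_cast; ring, ← smul_sub, ← map_sub,
        ← neg_sub ((mode α (i : ℤ)) ((mode β (j : ℤ)) w)), hαβ]
      have : (if (i : ℤ) + j = 0 then ((i : ℤ) : ℂ) * κ else 0) = 0 := by
        split_ifs with h
        · rw [show i = 0 by omega]; simp
        · rfl
      rw [this, zero_smul, add_zero, map_neg, smul_neg]
      push_cast
      rfl
    simp_rw [this, Finset.sum_neg_distrib]
    rw [box_sum (fun i j => bq m i * bq n j)
      (fun s => (mode φ (k + (m + n) - (s : ℕ))) ((mode γ (((s : ℕ) : ℤ))) w)) N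
      (fun s hs => by rw [hK₁ _ (by omega), map_zero])]
    simp_rw [bq_conv]
  have s₃ : (∑ i ∈ Finset.range N, ∑ j ∈ Finset.range N, (bp m i * bq n j) •
          (mode α (m - i)) ((mode φ (k + i + n - j)) ((mode β ((j : ℤ))) w))) =
      ∑ i ∈ Finset.range N, ∑ j ∈ Finset.range N, (bq n i * bp m j) •
          (mode α (m - j)) ((mode φ (k + n - i + j)) ((mode β ((i : ℤ))) w)) := by
    rw [Finset.sum_comm]
    refine Finset.sum_congr rfl fun i _ => Finset.sum_congr rfl fun j _ => ?_
    rw [mul_comm, show k + j + n - i = k + n - i + j by ring]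
  have s₄ : (∑ i ∈ Finset.range N, ∑ j ∈ Finset.range N, (bp n i * bq m j) •
          (mode β (n - i)) ((mode φ (k + i + m - j)) ((mode α ((j : ℤ))) w))) =
      ∑ i ∈ Finset.range N, ∑ j ∈ Finset.range N, (bq m i * bp n j) •
          (mode β (n - j)) ((mode φ (k + m - i + j)) ((mode α ((i : ℤ))) w)) := by
    rw [Finset.sum_comm]
    refine Finset.sum_congr rfl fun i _ => Finset.sum_congr rfl fun j _ => ?_
    rw [mul_comm, show k + j + m - i = k + m - i + j by ring]
  rw [s₃, s₄]
  have h := congrArg₂ (· + ·) s₁ s₂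
  refine Eq.trans ?_ (h.trans ?_) <;> abel


theorem sum_ite_shift {M : Type*} [AddCommGroup M] (N : ℕ) (t : ℤ) (f : ℕ → M) :
    (∑ i ∈ Finset.range N, if (i : ℤ) = t then f i else 0) =
      if 0 ≤ t ∧ t < N then f t.toNat else 0 := by
  split_ifs with h
  · rw [Finset.sum_eq_single t.toNat]
    · rw [if_pos (by omega)]
    · intro b _ hb
      rw [if_neg (by omega)]
    · intro hc
      exact absurd (Finset.mem_range.2 (by omega)) hc
  · refine Finset.sum_eq_zero fun i hi => ?_
    rw [if_neg]
    have := Finset.mem_range.1 hi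
    omega

/-- `α(x)_n 1 = 0` for `n ≥ 0`. -/
theorem nthProduct_idField (α : VertexOperator ℂ V) (n : ℤ) (hn : 0 ≤ n) :
    nthProduct n α idField = 0 := by
  refine vo_ext fun m w => ?_
  obtain ⟨N, h, hN⟩ := ((nthMode_eventually n α idField m w).and
    (Filter.eventually_gt_atTop (n.toNat + m.natAbs + 1))).exists
  have h0 : mode (0 : VertexOperator ℂ V) m w = 0 := by simp [mode]
  rw [ncoeff_nthProduct, h, h0]
  simp only [ncoeff_idField]
  have e₁ : ∀ i : ℕ, bp n i • mode α (n - i) (if m + i = -1 then w else 0) =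
      if (i : ℤ) = -1 - m then bp n i • mode α (n - i) w else 0 := by
    intro i
    by_cases h : (i : ℤ) = -1 - m
    · rw [if_pos (by omega), if_pos h]
    · rw [if_neg (by omega), if_neg h, map_zero, smul_zero]
  have e₂ : ∀ i : ℕ, bq n i • (if m + n - i = -1 then mode α i w else 0) =
      if (i : ℤ) = m + n + 1 then bq n i • mode α i w else 0 := by
    intro i
    by_cases h : (i : ℤ) = m + n + 1
    · rw [if_pos (by omega), if_pos h]
    · rw [if_neg (by omega), if_neg h, smul_zero]
  simp only [e₁, e₂]
  rw [sum_ite_shift, sum_ite_shift]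
  obtain ⟨n, rfl⟩ := Int.eq_ofNat_of_zero_le hn
  by_cases h₁ : m ≤ -1
  · rw [if_pos (by omega)]
    by_cases h₂ : 0 ≤ m + n + 1
    · rw [if_pos (by omega)]
      obtain ⟨s, hs⟩ := Int.eq_ofNat_of_zero_le (show 0 ≤ -1 - m by omega)
      obtain ⟨t, ht⟩ := Int.eq_ofNat_of_zero_le h₂
      rw [hs, ht, Int.toNat_natCast, Int.toNat_natCast]
      have hst : n = s + t := by omega
      rw [show (n : ℤ) - s = t by omega, bp, bq, Ring.choose_natCast, Ring.choose_natCast,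
        Nat.choose_symm_of_eq_add hst]
      rw [show ((n : ℤ) + (t : ℤ)) = ((n + t : ℕ) : ℤ) by push_cast; ring, zpow_natCast, hst,
        show s + t + t = s + 2 * t by ring, pow_add _ s (2 * t), pow_mul]
      simp
    · rw [if_neg (by omega), bp]
      obtain ⟨s, hs⟩ := Int.eq_ofNat_of_zero_le (show 0 ≤ -1 - m by omega)
      rw [hs, Int.toNat_natCast, Ring.choose_natCast, Nat.choose_eq_zero_of_lt (by omega)]
      simp
  · rw [if_neg (by omega)]
    by_cases h₂ : 0 ≤ m + n + 1
    · rw [if_pos (by omega), bq]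
      obtain ⟨t, ht⟩ := Int.eq_ofNat_of_zero_le h₂
      rw [ht, Int.toNat_natCast, Ring.choose_natCast, Nat.choose_eq_zero_of_lt (by omega)]
      simp
    · rw [if_neg (by omega), sub_zero]

/-- `α(x)_{-1} 1 = α(x)`. -/
theorem nthProduct_neg_one_idField (α : VertexOperator ℂ V) :
    nthProduct (-1) α idField = α := by
  refine vo_ext fun m w => ?_
  obtain ⟨N, h, hN⟩ := ((nthMode_eventually (-1) α idField m w).and
    (Filter.eventually_gt_atTop (m.natAbs + 1))).exists
  have hc : ∀ s : ℕ, bp (-1) s = 1 := by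
    intro s
    have h1 := Ring.choose_neg (1 : ℤ) s
    rw [show (1 : ℤ) + s - 1 = s by ring, Ring.choose_natCast, Nat.choose_self] at h1
    rw [bp, h1]
    rw [Units.smul_def, Int.negOnePow_def]
    push_cast
    rw [smul_eq_mul]
    push_cast
    rw [zpow_natCast, mul_one]
    push_cast
    rw [← mul_pow]
    simp
  rw [ncoeff_nthProduct, h]
  simp only [ncoeff_idField, bq_eq, hc]
  have e₁ : ∀ i : ℕ, (1 : ℂ) • mode α (-1 - i) (if m + i = -1 then w else 0) =
      if (i : ℤ) = -1 - m then mode α (-1 - i) w else 0 := by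
    intro i
    by_cases h : (i : ℤ) = -1 - m
    · rw [if_pos (by omega), if_pos h, one_smul]
    · rw [if_neg (by omega), if_neg h, map_zero, smul_zero]
  have e₂ : ∀ i : ℕ, ((-1 : ℂ) ^ (-1 : ℤ) * 1) • (if m + -1 - i = -1 then mode α i w else 0) =
      if (i : ℤ) = m then -mode α i w else 0 := by
    intro i
    by_cases h : (i : ℤ) = m
    · rw [if_pos (by omega), if_pos h]; norm_num
    · rw [if_neg (by omega), if_neg h, smul_zero]
  simp only [e₁, e₂]
  rw [sum_ite_shift, sum_ite_shift]
  by_cases h₁ : 0 ≤ m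
  · rw [if_neg (by omega), if_pos (by omega), zero_sub, neg_neg]
    congr 2
    omega
  · rw [if_pos (by omega), if_neg (by omega), sub_zero]
    congr 2
    omega

end Fields

section Nondegeneracy

/-! ### Iterated Laurent series

`W((x₁))⋯((xₙ))` consists of the families of coefficients `k ↦ f k`, `k ∈ ℤⁿ`, whose exponents of
`xₙ` are bounded below and, for each fixed exponent of `xₙ`, whose remaining part lies in
`W((x₁))⋯((xₙ₋₁))`. These are exactly the Hahn series on `ℤⁿ` with the colexicographic order (the
last exponent being the most significant), see `isPWO_support_iff`. -/

/-- The exponents of monomials `x₁^k₁ ⋯ xₙ^kₙ`. -/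
def Expo (n : ℕ) : Type := Fin n → ℤ

/-- Exponents as tuples of integers. -/
def Expo.toFun {n : ℕ} (k : Expo n) : Fin n → ℤ := k

/-- Tuples of integers as exponents. -/
def Expo.mk {n : ℕ} (k : Fin n → ℤ) : Expo n := k

instance (n : ℕ) : AddCommGroup (Expo n) := inferInstanceAs (AddCommGroup (Fin n → ℤ))

/-- Exponents are ordered colexicographically. -/
instance (n : ℕ) : LinearOrder (Expo n) := inferInstanceAs (LinearOrder (Colex (Fin n → ℤ)))

theorem Expo.lt_iff {n : ℕ} {k k' : Expo n} :
    k < k' ↔ ∃ i, (∀ j, i < j → k.toFun j = k'.toFun j) ∧ k.toFun i < k'.toFun i := Iff.rfl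

theorem Expo.toFun_add {n : ℕ} (k k' : Expo n) (i : Fin n) :
    (k + k').toFun i = k.toFun i + k'.toFun i := rfl

instance (n : ℕ) : IsOrderedAddMonoid (Expo n) where
  add_le_add_left x y hxy z := by
    rw [← not_lt] at hxy ⊢
    rintro h
    obtain ⟨i, h₁, h₂⟩ := Expo.lt_iff.1 h
    refine hxy (Expo.lt_iff.2 ⟨i, fun j hj => ?_, ?_⟩)
    · have := h₁ j hj
      simp only [Expo.toFun_add] at this
      omega
    · simp only [Expo.toFun_add] at h₂
      omega

/-- `f` is the family of coefficients of an element of `W((x₁))⋯((xₙ))`. -/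
def IsIterLaurent {W : Type*} [Zero W] : (n : ℕ) → ((Fin n → ℤ) → W) → Prop
  | 0, _ => True
  | n + 1, f => (∃ N : ℤ, ∀ k : Fin (n + 1) → ℤ, k (Fin.last n) < N → f k = 0) ∧
      ∀ m : ℤ, IsIterLaurent n (fun k : Fin n → ℤ => f (Fin.snoc k m))

theorem snoc_lt_snoc {n : ℕ} {k k' : Fin n → ℤ} {m : ℤ} :
    Expo.mk (Fin.snoc k m : Fin (n + 1) → ℤ) < Expo.mk (Fin.snoc k' m : Fin (n + 1) → ℤ) ↔
      Expo.mk k < Expo.mk k' := by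
  rw [Expo.lt_iff, Expo.lt_iff]
  simp only [Expo.toFun, Expo.mk]
  constructor
  · rintro ⟨i, h₁, h₂⟩
    induction i using Fin.lastCases with
    | last => simp at h₂
    | cast i =>
      refine ⟨i, fun j hj => ?_, by simpa using h₂⟩
      simpa using h₁ j.castSucc hj
  · rintro ⟨i, h₁, h₂⟩
    refine ⟨i.castSucc, fun j hj => ?_, by simpa using h₂⟩
    induction j using Fin.lastCases with
    | last => simp
    | cast j => simpa using h₁ j hj

theorem isWF_iff_exists_min {α : Type*} [LinearOrder α] (S : Set α) :
    S.IsWF ↔ ∀ T ⊆ S, T.Nonempty → ∃ a ∈ T, ∀ b ∈ T, a ≤ b := by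
  constructor
  · intro h T hT hne
    have hT' := h.mono hT
    exact ⟨hT'.min hne, hT'.min_mem hne, fun b hb => hT'.min_le hne hb⟩
  · intro h
    rw [Set.isWF_iff_no_descending_seq]
    intro f hf hS
    obtain ⟨_, ⟨i, rfl⟩, hi⟩ := h (Set.range f) (by rintro _ ⟨i, rfl⟩; exact hS i)
      ⟨f 0, 0, rfl⟩
    exact absurd (hf (Nat.lt_succ_self i)) (not_lt.2 (hi _ ⟨i + 1, rfl⟩))

/-- Iterated Laurent series are the same as Hahn series with exponents in colexicographically
ordered `ℤⁿ`. -/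
theorem isPWO_support_iff {W : Type*} [Zero W] {n : ℕ} (f : (Fin n → ℤ) → W) :
    (Function.support fun k : Expo n => f k.toFun).IsPWO ↔ IsIterLaurent n f := by
  induction n with
  | zero =>
    simp only [IsIterLaurent, iff_true]
    have : Subsingleton (Expo 0) := inferInstanceAs (Subsingleton (Fin 0 → ℤ))
    exact Set.subsingleton_of_subsingleton.isPWO
  | succ n ih =>
    rw [Set.isPWO_iff_isWF]
    constructor
    · intro h
      rw [isWF_iff_exists_min] at h
      constructor
      · by_cases hne : (Function.support fun k : Expo (n + 1) => f k.toFun).Nonempty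
        · obtain ⟨a, ha, hmin⟩ := h _ le_rfl hne
          refine ⟨a.toFun (Fin.last n), fun k hk => ?_⟩
          by_contra hc
          refine absurd (hmin (Expo.mk k) hc) (not_le.2 ⟨Fin.last n, fun j hj => ?_, hk⟩)
          exact absurd (Fin.le_last j) (not_le.2 hj)
        · refine ⟨0, fun k _ => ?_⟩
          by_contra hc
          exact hne ⟨Expo.mk k, hc⟩
      · intro m
        rw [← ih, Set.isPWO_iff_isWF, isWF_iff_exists_min]
        intro T hT hTne
        obtain ⟨_, ⟨a, haT, rfl⟩, hmin⟩ := h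
          ((fun k : Expo n => Expo.mk (Fin.snoc k.toFun m : Fin (n + 1) → ℤ)) '' T)
          (by rintro _ ⟨k, hk, rfl⟩; exact hT hk) (hTne.image _)
        refine ⟨a, haT, fun b hb => ?_⟩
        have := hmin _ ⟨b, hb, rfl⟩
        rw [← not_lt] at this ⊢
        exact fun hlt => this (snoc_lt_snoc.2 hlt)
    · rintro ⟨⟨N, hN⟩, hslice⟩
      rw [isWF_iff_exists_min]
      intro T hT hTne
      obtain ⟨m, ⟨k₀, hk₀, hm⟩, hmin⟩ :=
        Int.exists_least_of_bdd (P := fun m => ∃ k ∈ T, k.toFun (Fin.last n) = m)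
          ⟨N, by
            rintro z ⟨k, hk, rfl⟩
            by_contra hc
            exact hT hk (hN _ (not_le.1 hc))⟩
          ⟨_, hTne.some, hTne.some_mem, rfl⟩
      have hw := (ih _).2 (hslice m)
      rw [Set.isPWO_iff_isWF, isWF_iff_exists_min] at hw
      have hsn : ∀ k : Expo (n + 1), k.toFun (Fin.last n) = m →
          Expo.mk (Fin.snoc (fun i => k.toFun i.castSucc) m : Fin (n + 1) → ℤ) = k := by
        rintro k rfl
        exact Fin.snoc_init_self (α := fun _ => ℤ) k.toFun
      obtain ⟨a, ha, hamin⟩ := hw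
        {k | Expo.mk (Fin.snoc k.toFun m : Fin (n + 1) → ℤ) ∈ T}
        (fun k hk => hT hk)
        ⟨Expo.mk (fun i => k₀.toFun i.castSucc), by
          change Expo.mk (Fin.snoc (fun i => k₀.toFun i.castSucc) m : Fin (n + 1) → ℤ) ∈ T
          rw [hsn k₀ hm]; exact hk₀⟩
      refine ⟨_, ha, fun b hb => ?_⟩
      rcases (hmin _ ⟨b, hb, rfl⟩).lt_or_eq with hlt | heq
      · refine le_of_lt ⟨Fin.last n, fun j hj => absurd (Fin.le_last j) (not_le.2 hj), ?_⟩
        change (Fin.snoc a.toFun m : Fin (n + 1) → ℤ) (Fin.last n) < b.toFun (Fin.last n)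
        rw [Fin.snoc_last]
        exact hlt
      · rw [← hsn b heq.symm] at hb ⊢
        have := hamin (Expo.mk fun i => b.toFun i.castSucc) hb
        rw [← not_lt] at this ⊢
        exact fun hlt => this (snoc_lt_snoc.1 hlt)

/-- The field `ℂ((x₁))⋯((xₙ))`. -/
abbrev IterLaurent (n : ℕ) : Type := HahnSeries (Expo n) ℂ

/-- The space `V((x₁))⋯((xₙ))`, a module over `ℂ((x₁))⋯((xₙ))`. -/
abbrev IterLaurentModule (n : ℕ) (V : Type*) [AddCommGroup V] [Module ℂ V] : Type _ :=
  HahnModule (Expo n) ℂ V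

variable {V : Type*} [AddCommGroup V] [Module ℂ V]

/-- The coefficient of `x₁^k₁ ⋯ xₙ^kₙ` in `Y(u₁, x₁) ⋯ Y(uₙ, xₙ)`. -/
def prodCoeff (Y : V →ₗ[ℂ] VertexOperator ℂ V) (n : ℕ) (u : Fin n → V) (k : Fin n → ℤ) :
    Module.End ℂ V :=
  (List.ofFn fun i => HVertexOperator.coeff (Y (u i)) (k i)).prod

theorem prodCoeff_eq (Y : V →ₗ[ℂ] VertexOperator ℂ V) (n : ℕ) (u : Fin n → V) (k : Fin n → ℤ) :
    prodCoeff Y n u k = (MultilinearMap.mkPiAlgebraFin ℂ n (Module.End ℂ V)).compLinearMap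
      (fun i => (LinearMap.proj (k i)) ∘ₗ HVertexOperator.coeff ∘ₗ Y) u := by
  rw [MultilinearMap.compLinearMap_apply, MultilinearMap.mkPiAlgebraFin_apply]
  rfl

theorem isIterLaurent_prodCoeff (Y : V →ₗ[ℂ] VertexOperator ℂ V) (n : ℕ) (u : Fin n → V) (w : V) :
    IsIterLaurent n fun k => prodCoeff Y n u k w := by
  induction n generalizing w with
  | zero => trivial
  | succ n ih =>
    have e : ∀ k, prodCoeff Y (n + 1) u k w = prodCoeff Y n (fun i => u i.castSucc)
        (fun i => k i.castSucc) (HVertexOperator.coeff (Y (u (Fin.last n))) (k (Fin.last n)) w) := by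
      intro k
      rw [prodCoeff, prodCoeff, List.ofFn_succ', List.concat_eq_append, List.prod_append,
        List.prod_singleton, Module.End.mul_apply]
    constructor
    · refine ⟨HahnSeries.order ((HahnModule.of ℂ).symm (Y (u (Fin.last n)) w)), fun k hk => ?_⟩
      change prodCoeff Y (n + 1) u k w = 0
      rw [e, VertexOperator.coeff_eq_zero_of_lt_order _ _ _ hk, map_zero]
    · intro m
      simp only [e, Fin.snoc_castSucc, Fin.snoc_last]
      exact ih _ _

/-- The series `Y(u₁, x₁) ⋯ Y(uₙ, xₙ) w ∈ V((x₁))⋯((xₙ))`, as a multilinear map in `u₁, …, uₙ`. -/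
def iterY (Y : V →ₗ[ℂ] VertexOperator ℂ V) (w : V) (n : ℕ) :
    MultilinearMap ℂ (fun _ : Fin n => V) (IterLaurentModule n V) where
  toFun u := HahnModule.of ℂ
    { coeff := fun k => prodCoeff Y n u k.toFun w
      isPWO_support' := (isPWO_support_iff _).2 (isIterLaurent_prodCoeff Y n u w) }
  map_update_add' := by
    intro hdec u i x y
    obtain rfl : hdec = instDecidableEqFin n := Subsingleton.elim _ _
    refine HahnModule.ext _ _ (funext fun k => ?_)
    change prodCoeff Y n _ k.toFun w = prodCoeff Y n _ k.toFun w + prodCoeff Y n _ k.toFun w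
    rw [prodCoeff_eq, prodCoeff_eq, prodCoeff_eq, MultilinearMap.map_update_add,
      LinearMap.add_apply]
  map_update_smul' := by
    intro hdec u i c x
    obtain rfl : hdec = instDecidableEqFin n := Subsingleton.elim _ _
    refine HahnModule.ext _ _ (funext fun k => ?_)
    change prodCoeff Y n _ k.toFun w = c • prodCoeff Y n _ k.toFun w
    rw [prodCoeff_eq, prodCoeff_eq, MultilinearMap.map_update_smul, LinearMap.smul_apply]

theorem iterLaurent_smul_comm {n : ℕ} (f : IterLaurent n) (c : ℂ) (y : IterLaurentModule n V) :
    f • c • y = c • f • y := by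
  have h : ∀ z : IterLaurentModule n V, c • z = (HahnSeries.single (0 : Expo n) c) • z :=
    fun z => (HahnModule.single_zero_smul_eq_smul (Expo n)).symm
  rw [h y, h (f • y)]
  exact (mul_smul f _ y).symm.trans ((congrArg (· • y) (mul_comm f _)).trans (mul_smul _ f y))

/-- The linear map `Z_n : V^{⊗n} ⊗ ℂ((x₁))⋯((xₙ)) → V((x₁))⋯((xₙ))`,
`u₁ ⊗ ⋯ ⊗ uₙ ⊗ f ↦ f Y(u₁, x₁) ⋯ Y(uₙ, xₙ) 𝟏`. -/
def Z (Y : V →ₗ[ℂ] VertexOperator ℂ V) (vac : V) (n : ℕ) :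
    (PiTensorProduct ℂ fun _ : Fin n => V) ⊗[ℂ] IterLaurent n →ₗ[ℂ] IterLaurentModule n V :=
  TensorProduct.lift (LinearMap.mk₂ ℂ
    (fun t f => f • PiTensorProduct.lift (iterY Y vac n) t)
    (fun t t' f => by rw [map_add, smul_add])
    (fun c t f => by rw [map_smul, iterLaurent_smul_comm])
    (fun t f f' => add_smul _ _ _)
    (fun c t f => smul_assoc _ _ _))

theorem Z_tmul (Y : V →ₗ[ℂ] VertexOperator ℂ V) (vac : V) (n : ℕ) (u : Fin n → V)
    (f : IterLaurent n) :
    Z Y vac n (PiTensorProduct.tprod ℂ u ⊗ₜ[ℂ] f) = f • iterY Y vac n u := by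
  simp [Z]

end Nondegeneracy

/-- The data `(V, Y, 𝟏)` of a (nonlocal) vertex algebra: the vertex operator map
`Y(·, x) : V → Hom(V, V((x)))` and the vacuum vector. Nondegeneracy is a property of this data. -/
structure VertexAlgebraData (V : Type*) [AddCommGroup V] [Module ℂ V] where
  /-- The vertex operator map `v ↦ Y(v, x)`. -/
  Y : V →ₗ[ℂ] VertexOperator ℂ V
  /-- The vacuum vector `𝟏`. -/
  vac : V

/-- `V` is nondegenerate if `Z_n : V^{⊗n} ⊗ ℂ((x₁))⋯((xₙ)) → V((x₁))⋯((xₙ))` is injective for every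
positive integer `n`. -/
def VertexAlgebraData.Nondegenerate {V : Type*} [AddCommGroup V] [Module ℂ V]
    (A : VertexAlgebraData V) : Prop :=
  ∀ n : ℕ, 0 < n → Function.Injective (Z A.Y A.vac n)

section Affine

open LieAlgebra LieModule

attribute [local instance] LieRing.ofAssociativeRing

variable {𝔤 : Type*} [LieRing 𝔤] [LieAlgebra ℂ 𝔤] (B : LinearMap.BilinForm ℂ 𝔤)
  (hs : B.IsSymm) (hi : B.lieInvariant 𝔤)

/-- The 2-cocycle `(a ⊗ t^m, b ⊗ t^n) ↦ m ⟨a, b⟩ δ_{m+n,0}` on the loop algebra. (Mathlib's cocycle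
attached to `B` is `(f, g) ↦ Res f dg`, so the one attached to `-B` is used.) -/
def affineCocycle : Cohomology.twoCocycle ℂ (loopAlgebra ℂ ℤ 𝔤)
    (TrivialLieModule ℂ (loopAlgebra ℂ ℤ 𝔤) ℂ) :=
  LoopAlgebra.twoCocycleOfBilinear ℂ ℤ 𝔤 (-B)
    (fun x y z => by rw [LinearMap.neg_apply, LinearMap.neg_apply, hi x y z]; simp)
    ⟨fun x y => by simpa using hs.eq x y⟩

theorem affineCocycle_apply (f g : loopAlgebra ℂ ℤ 𝔤) :
    (affineCocycle B hs hi : _ →ₗ[ℂ] _ →ₗ[ℂ] _) f g =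
      (TrivialLieModule.equiv ℂ (loopAlgebra ℂ ℤ 𝔤) ℂ).symm
        (LoopAlgebra.residuePairing ℂ ℤ 𝔤 (-B) f g) := rfl

theorem affineCocycle_tmul (m n : ℤ) (a b : 𝔤) :
    (affineCocycle B hs hi : _ →ₗ[ℂ] _ →ₗ[ℂ] _)
      (AddMonoidAlgebra.single m (1 : ℂ) ⊗ₜ[ℂ] a) (AddMonoidAlgebra.single n (1 : ℂ) ⊗ₜ[ℂ] b) =
      (TrivialLieModule.equiv ℂ (loopAlgebra ℂ ℤ 𝔤) ℂ).symm
        (if m + n = 0 then (m : ℂ) * B a b else 0) := by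
  rw [affineCocycle_apply, LoopAlgebra.residuePairing_apply_apply,
    LoopAlgebra.toFinsupp_single_tmul, LoopAlgebra.toFinsupp_single_tmul,
    Finsupp.sum_single_index (by simp)]
  congr 1
  split_ifs with h
  · obtain rfl : n = -m := by omega
    simp
  · rw [Finsupp.single_eq_of_ne (by omega)]
    simp

/-- The affine Lie algebra `𝔤 ⊗ ℂ[t, t⁻¹] ⊕ ℂ c`. -/
abbrev AffineLieAlgebra : Type _ := LieAlgebra.ofTwoCocycle (affineCocycle B hs hi)

/-- The element `a ⊗ t^n` of the affine Lie algebra. -/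
def loopElt (n : ℤ) : 𝔤 →ₗ[ℂ] AffineLieAlgebra B hs hi where
  toFun a := ofProd _ (AddMonoidAlgebra.single n (1 : ℂ) ⊗ₜ[ℂ] a, 0)
  map_add' a b := by rw [← of_add]; simp [TensorProduct.tmul_add]
  map_smul' r a := by rw [RingHom.id_apply, ← of_smul]; simp

/-- The central element `c` of the affine Lie algebra. -/
def centralElt : AffineLieAlgebra B hs hi :=
  ofProd _ (0, (TrivialLieModule.equiv ℂ (loopAlgebra ℂ ℤ 𝔤) ℂ).symm 1)

/-- `[a ⊗ t^m, b ⊗ t^n] = [a, b] ⊗ t^(m+n) + m ⟨a, b⟩ δ_{m+n,0} c`. -/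
theorem lie_loopElt (m n : ℤ) (a b : 𝔤) :
    ⁅loopElt B hs hi m a, loopElt B hs hi n b⁆ = loopElt B hs hi (m + n) ⁅a, b⁆ +
      (if m + n = 0 then (m : ℂ) * B a b else 0) • centralElt B hs hi := by
  rw [bracket_ofTwoCocycle, loopElt, loopElt, loopElt, centralElt]
  simp only [LinearMap.coe_mk, AddHom.coe_mk, Equiv.symm_apply_apply, trivial_lie_zero, add_zero,
    sub_zero, affineCocycle_tmul]
  rw [← of_smul, ← of_add]
  refine Equiv.congr_arg ?_
  simp only [LieAlgebra.ExtendScalars.bracket_tmul, Prod.smul_mk, smul_zero, Prod.mk_add_mk,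
    add_zero, zero_add, AddMonoidAlgebra.single_mul_single, mul_one, ← map_smul,
    smul_eq_mul]

theorem lie_centralElt (x : AffineLieAlgebra B hs hi) : ⁅centralElt B hs hi, x⁆ = 0 := by
  rw [bracket_ofTwoCocycle, ← of_zero]
  refine Equiv.congr_arg ?_
  simp [centralElt, trivial_lie_zero]

/-- Linear extension of a family `D n a` to the loop algebra, `a ⊗ t^n ↦ D n a`. -/
def loopLift {M : Type*} [AddCommGroup M] [Module ℂ M] (D : ℤ → 𝔤 →ₗ[ℂ] M) :
    loopAlgebra ℂ ℤ 𝔤 →ₗ[ℂ] M :=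
  (Finsupp.lsum ℂ D) ∘ₗ (LoopAlgebra.toFinsupp ℂ ℤ 𝔤).toLinearMap

theorem loopLift_tmul {M : Type*} [AddCommGroup M] [Module ℂ M] (D : ℤ → 𝔤 →ₗ[ℂ] M) (n : ℤ)
    (a : 𝔤) : loopLift D (AddMonoidAlgebra.single n (1 : ℂ) ⊗ₜ[ℂ] a) = D n a := by
  rw [loopLift, LinearMap.comp_apply, LinearEquiv.coe_coe, LoopAlgebra.toFinsupp_single_tmul,
    Finsupp.lsum_single]

/-- Induction principle: the affine algebra is spanned by the `a ⊗ t^n` and `c`. -/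
theorem affine_induction {p : AffineLieAlgebra B hs hi → Prop}
    (hl : ∀ n a, p (loopElt B hs hi n a)) (hc : p (centralElt B hs hi))
    (hadd : ∀ x y, p x → p y → p (x + y)) (hsmul : ∀ (r : ℂ) x, p x → p (r • x))
    (x : AffineLieAlgebra B hs hi) : p x := by
  have h0 : p 0 := by simpa using hsmul 0 _ hc
  obtain ⟨⟨f, z⟩⟩ := x
  have e : (⟨(f, z)⟩ : AffineLieAlgebra B hs hi) = ofProd _ (f, 0) + ofProd _ (0, z) := by
    rw [← of_add]; simp; rfl
  rw [e]
  refine hadd _ _ ?_ ?_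
  · rw [← (LoopAlgebra.toFinsupp ℂ ℤ 𝔤).symm_apply_apply f]
    induction (LoopAlgebra.toFinsupp ℂ ℤ 𝔤) f using Finsupp.induction_linear with
    | zero => rw [map_zero]; exact h0
    | add f g hf hg =>
      have := hadd _ _ hf hg
      rw [← of_add] at this
      simpa using this
    | single n a =>
      rw [LoopAlgebra.toFinsupp_symm_single]
      exact hl n a
  · have := hsmul (TrivialLieModule.equiv ℂ (loopAlgebra ℂ ℤ 𝔤) ℂ z) _ hc
    rw [centralElt, ← of_smul] at this
    have e : (TrivialLieModule.equiv ℂ (loopAlgebra ℂ ℤ 𝔤) ℂ z) •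
        ((0 : loopAlgebra ℂ ℤ 𝔤), (TrivialLieModule.equiv ℂ (loopAlgebra ℂ ℤ 𝔤) ℂ).symm 1) =
        (0, z) := by
      rw [Prod.smul_mk, smul_zero, ← map_smul, smul_eq_mul, mul_one, LinearEquiv.symm_apply_apply]
    rwa [e] at this

/-- The linear map out of the affine algebra given by `a ⊗ t^n ↦ D n a`, `c ↦ z`. -/
def affineLinearLift {M : Type*} [AddCommGroup M] [Module ℂ M] (D : ℤ → 𝔤 →ₗ[ℂ] M) (z : M) :
    AffineLieAlgebra B hs hi →ₗ[ℂ] M where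
  toFun x := loopLift D ((ofProd _).symm x).1 +
    (TrivialLieModule.equiv ℂ (loopAlgebra ℂ ℤ 𝔤) ℂ ((ofProd _).symm x).2) • z
  map_add' x y := by
    simp only [of_symm_add, Prod.fst_add, Prod.snd_add, map_add, add_smul]
    abel
  map_smul' r x := by
    simp only [of_symm_smul, Prod.smul_fst, Prod.smul_snd, map_smul, RingHom.id_apply, smul_add,
      smul_smul, smul_eq_mul]

theorem affineLinearLift_loopElt {M : Type*} [AddCommGroup M] [Module ℂ M] (D : ℤ → 𝔤 →ₗ[ℂ] M)
    (z : M) (n : ℤ) (a : 𝔤) : affineLinearLift B hs hi D z (loopElt B hs hi n a) = D n a := by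
  simp only [affineLinearLift, loopElt, LinearMap.coe_mk, AddHom.coe_mk, Equiv.symm_apply_apply,
    loopLift_tmul, map_zero, zero_smul, add_zero]

theorem affineLinearLift_centralElt {M : Type*} [AddCommGroup M] [Module ℂ M]
    (D : ℤ → 𝔤 →ₗ[ℂ] M) (z : M) :
    affineLinearLift B hs hi D z (centralElt B hs hi) = z := by
  simp only [affineLinearLift, centralElt, LinearMap.coe_mk, AddHom.coe_mk, Equiv.symm_apply_apply,
    map_zero, LinearEquiv.apply_symm_apply, one_smul, zero_add]

/-- The representation of the affine algebra with `a ⊗ t^n` acting as `D n a` and `c` acting as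
the scalar `ℓ`, for operators `D n a` satisfying the affine commutation relations. -/
def affineRep {M : Type*} [AddCommGroup M] [Module ℂ M] (D : ℤ → 𝔤 →ₗ[ℂ] Module.End ℂ M) (ℓ : ℂ)
    (hD : ∀ m n a b, D m a * D n b - D n b * D m a =
      D (m + n) ⁅a, b⁆ + (if m + n = 0 then (m : ℂ) * B a b else 0) • (ℓ • 1)) :
    AffineLieAlgebra B hs hi →ₗ⁅ℂ⁆ Module.End ℂ M where
  __ := affineLinearLift B hs hi D (ℓ • 1)
  map_lie' := by
    intro x y
    change affineLinearLift B hs hi D (ℓ • 1) ⁅x, y⁆ =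
      ⁅affineLinearLift B hs hi D (ℓ • 1) x, affineLinearLift B hs hi D (ℓ • 1) y⁆
    have hcx : ∀ T : Module.End ℂ M, ⁅(ℓ • 1 : Module.End ℂ M), T⁆ = 0 := by
      intro T
      rw [LieRing.of_associative_ring_bracket]
      simp
    induction x using affine_induction with
    | hc =>
      rw [lie_centralElt, map_zero, affineLinearLift_centralElt, hcx]
    | hadd x₁ x₂ h₁ h₂ => rw [add_lie, map_add, map_add, add_lie, h₁, h₂]
    | hsmul r x h => rw [smul_lie, map_smul, map_smul, smul_lie, h]
    | hl m a =>
      induction y using affine_induction with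
      | hc =>
        rw [← lie_skew, lie_centralElt, ← lie_skew, affineLinearLift_centralElt, hcx]
        simp
      | hadd x₁ x₂ h₁ h₂ => rw [lie_add, map_add, map_add, lie_add, h₁, h₂]
      | hsmul r x h => rw [lie_smul, map_smul, map_smul, lie_smul, h]
      | hl n b =>
        rw [lie_loopElt, map_add, map_smul, affineLinearLift_loopElt, affineLinearLift_loopElt,
          affineLinearLift_loopElt, affineLinearLift_centralElt, ← hD,
          LieRing.of_associative_ring_bracket]

theorem affineRep_apply {M : Type*} [AddCommGroup M] [Module ℂ M]
    (D : ℤ → 𝔤 →ₗ[ℂ] Module.End ℂ M) (ℓ : ℂ) (hD) (x : AffineLieAlgebra B hs hi) :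
    affineRep B hs hi D ℓ hD x = affineLinearLift B hs hi D (ℓ • 1) x := rfl

variable (ℓ : ℂ)

/-- The left ideal of `U(𝔤̂)` generated by `𝔤[t]` and `c - ℓ`. -/
def vacuumIdeal : Submodule (UniversalEnvelopingAlgebra ℂ (AffineLieAlgebra B hs hi))
    (UniversalEnvelopingAlgebra ℂ (AffineLieAlgebra B hs hi)) :=
  Submodule.span _
    ({u | ∃ (n : ℕ) (a : 𝔤), u = UniversalEnvelopingAlgebra.ι ℂ (loopElt B hs hi n a)} ∪
      {UniversalEnvelopingAlgebra.ι ℂ (centralElt B hs hi) - algebraMap ℂ _ ℓ})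

/-- The underlying space of `V_𝔤̂(ℓ, 0)`: the induced module `U(𝔤̂) ⊗_{U(𝔤[t] ⊕ ℂ c)} ℂ_ℓ`, i.e. the
quotient of `U(𝔤̂)` by the left ideal generated by `𝔤[t]` and `c - ℓ`. -/
def VacuumModule : Type _ :=
  UniversalEnvelopingAlgebra ℂ (AffineLieAlgebra B hs hi) ⧸ vacuumIdeal B hs hi ℓ

instance : AddCommGroup (VacuumModule B hs hi ℓ) :=
  inferInstanceAs (AddCommGroup (_ ⧸ vacuumIdeal B hs hi ℓ))

instance : Module (UniversalEnvelopingAlgebra ℂ (AffineLieAlgebra B hs hi))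
    (VacuumModule B hs hi ℓ) :=
  inferInstanceAs (Module _ (_ ⧸ vacuumIdeal B hs hi ℓ))

instance : Module ℂ (VacuumModule B hs hi ℓ) :=
  inferInstanceAs (Module ℂ (_ ⧸ vacuumIdeal B hs hi ℓ))

instance : IsScalarTower ℂ (UniversalEnvelopingAlgebra ℂ (AffineLieAlgebra B hs hi))
    (VacuumModule B hs hi ℓ) :=
  inferInstanceAs (IsScalarTower ℂ _ (_ ⧸ vacuumIdeal B hs hi ℓ))

/-- The quotient map from `U(𝔤̂)` to the vacuum module. -/
def toVacuumModule : UniversalEnvelopingAlgebra ℂ (AffineLieAlgebra B hs hi)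
    →ₗ[UniversalEnvelopingAlgebra ℂ (AffineLieAlgebra B hs hi)] VacuumModule B hs hi ℓ :=
  (vacuumIdeal B hs hi ℓ).mkQ

theorem toVacuumModule_surjective : Function.Surjective (toVacuumModule B hs hi ℓ) :=
  Submodule.mkQ_surjective _

theorem toVacuumModule_eq_zero (u) : toVacuumModule B hs hi ℓ u = 0 ↔ u ∈ vacuumIdeal B hs hi ℓ :=
  Submodule.Quotient.mk_eq_zero _

/-- The vacuum vector `𝟏 = 1 ⊗ 1`. -/
def vacuum : VacuumModule B hs hi ℓ := toVacuumModule B hs hi ℓ 1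

/-- The action of `x ∈ 𝔤̂` on the vacuum module. -/
def affineAct : AffineLieAlgebra B hs hi →ₗ⁅ℂ⁆ Module.End ℂ (VacuumModule B hs hi ℓ) :=
  ((Algebra.lsmul ℂ ℂ (VacuumModule B hs hi ℓ)).toLieHom).comp (UniversalEnvelopingAlgebra.ι ℂ)

theorem affineAct_apply (x : AffineLieAlgebra B hs hi) (v : VacuumModule B hs hi ℓ) :
    affineAct B hs hi ℓ x v = UniversalEnvelopingAlgebra.ι ℂ x • v := rfl

theorem affineAct_lie (x y : AffineLieAlgebra B hs hi) (v : VacuumModule B hs hi ℓ) :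
    affineAct B hs hi ℓ x (affineAct B hs hi ℓ y v) -
      affineAct B hs hi ℓ y (affineAct B hs hi ℓ x v) = affineAct B hs hi ℓ ⁅x, y⁆ v := by
  rw [LieHom.map_lie, LieRing.of_associative_ring_bracket]
  rfl

/-- Induction principle: the vacuum module is generated by the vacuum vector under `𝔤̂`. -/
theorem vacuumModule_induction {p : VacuumModule B hs hi ℓ → Prop}
    (hvac : p (vacuum B hs hi ℓ)) (hadd : ∀ v w, p v → p w → p (v + w))
    (hsmul : ∀ (r : ℂ) v, p v → p (r • v))
    (hact : ∀ x v, p v → p (affineAct B hs hi ℓ x v)) (v : VacuumModule B hs hi ℓ) : p v := by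
  obtain ⟨u, rfl⟩ := toVacuumModule_surjective B hs hi ℓ v
  suffices H : ∀ u : UniversalEnvelopingAlgebra ℂ (AffineLieAlgebra B hs hi), ∀ v, p v →
      p (u • v) by
    have := H u _ hvac
    rwa [vacuum, ← map_smul, smul_eq_mul, mul_one] at this
  intro u
  obtain ⟨t, rfl⟩ : ∃ t, UniversalEnvelopingAlgebra.mkAlgHom ℂ _ t = u :=
    RingCon.mkₐ_surjective _ u
  induction t using TensorAlgebra.induction with
  | algebraMap r =>
    intro v hv
    rw [AlgHom.commutes, algebraMap_smul]
    exact hsmul r v hv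
  | ι x => exact fun v hv => hact x v hv
  | mul a b ha hb =>
    intro v hv
    rw [map_mul, mul_smul]
    exact ha _ (hb _ hv)
  | add a b ha hb =>
    intro v hv
    rw [map_add, add_smul]
    exact hadd _ _ (ha _ hv) (hb _ hv)

theorem affineAct_centralElt (v : VacuumModule B hs hi ℓ) :
    affineAct B hs hi ℓ (centralElt B hs hi) v = ℓ • v := by
  induction v using vacuumModule_induction with
  | hvac =>
    rw [affineAct_apply, vacuum, ← algebraMap_smul
      (UniversalEnvelopingAlgebra ℂ (AffineLieAlgebra B hs hi)) ℓ, ← map_smul, ← map_smul,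
      ← sub_eq_zero, ← map_sub, toVacuumModule_eq_zero]
    apply Submodule.subset_span
    right
    rw [Set.mem_singleton_iff, smul_eq_mul, mul_one, smul_eq_mul, mul_one]
  | hadd v w hv hw => rw [map_add, hv, hw, smul_add]
  | hsmul r v hv => rw [map_smul, hv, smul_comm]
  | hact x v hv =>
    have := affineAct_lie B hs hi ℓ (centralElt B hs hi) x v
    rw [lie_centralElt, map_zero, LinearMap.zero_apply, sub_eq_zero, hv, map_smul] at this
    exact this

theorem affineAct_nonneg_vacuum (n : ℕ) (a : 𝔤) :
    affineAct B hs hi ℓ (loopElt B hs hi n a) (vacuum B hs hi ℓ) = 0 := by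
  rw [affineAct_apply, vacuum, ← map_smul, toVacuumModule_eq_zero]
  apply Submodule.subset_span
  left
  exact ⟨n, a, by rw [smul_eq_mul, mul_one]⟩

/-- Each vector of the vacuum module is annihilated by `a ⊗ t^n` for large `n`. -/
theorem affineAct_trunc (v : VacuumModule B hs hi ℓ) :
    ∀ a, ∃ N : ℤ, ∀ n, N ≤ n → affineAct B hs hi ℓ (loopElt B hs hi n a) v = 0 := by
  induction v using vacuumModule_induction with
  | hvac =>
    refine fun a => ⟨0, fun n hn => ?_⟩
    obtain ⟨n, rfl⟩ := Int.eq_ofNat_of_zero_le hn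
    exact affineAct_nonneg_vacuum B hs hi ℓ n a
  | hadd v w hv hw =>
    intro a
    obtain ⟨N₁, h₁⟩ := hv a
    obtain ⟨N₂, h₂⟩ := hw a
    refine ⟨max N₁ N₂, fun n hn => ?_⟩
    rw [map_add, h₁ n (by omega), h₂ n (by omega), add_zero]
  | hsmul r v hv =>
    intro a
    obtain ⟨N, h⟩ := hv a
    exact ⟨N, fun n hn => by rw [map_smul, h n hn, smul_zero]⟩
  | hact x v hv =>
    induction x using affine_induction with
    | hl m b =>
      intro a
      obtain ⟨N₁, h₁⟩ := hv a
      obtain ⟨N₂, h₂⟩ := hv ⁅a, b⁆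
      refine ⟨max (max N₁ (N₂ - m)) (1 - m), fun n hn => ?_⟩
      have := affineAct_lie B hs hi ℓ (loopElt B hs hi n a) (loopElt B hs hi m b) v
      rw [h₁ n (by omega), lie_loopElt, if_neg (by omega), zero_smul, add_zero,
        h₂ _ (by omega), map_zero, sub_zero] at this
      exact this
    | hc =>
      intro a
      obtain ⟨N, h⟩ := hv a
      exact ⟨N, fun n hn => by rw [affineAct_centralElt, map_smul, h n hn, smul_zero]⟩
    | hadd x y hx hy =>
      intro a
      obtain ⟨N₁, h₁⟩ := hx a
      obtain ⟨N₂, h₂⟩ := hy a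
      refine ⟨max N₁ N₂, fun n hn => ?_⟩
      rw [map_add, LinearMap.add_apply, map_add, h₁ n (by omega), h₂ n (by omega), add_zero]
    | hsmul r x hx =>
      intro a
      obtain ⟨N, h⟩ := hx a
      exact ⟨N, fun n hn => by rw [map_smul, LinearMap.smul_apply, map_smul, h n hn, smul_zero]⟩

/-- The generating field `a(x) = ∑ (a ⊗ t^n) x^(-n-1)` acting on the vacuum module. -/
def current : 𝔤 →ₗ[ℂ] VertexOperator ℂ (VacuumModule B hs hi ℓ) where
  toFun a := VertexOperator.of_coeff
    (fun k => affineAct B hs hi ℓ (loopElt B hs hi (-k - 1) a)) (fun v => by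
      obtain ⟨N, h⟩ := affineAct_trunc B hs hi ℓ v a
      refine ⟨-N, fun k hk => ?_⟩
      by_contra hc
      exact hk (h _ (by omega)))
  map_add' a b := vo_ext fun m w => by
    rw [mode_add]
    change affineAct B hs hi ℓ (loopElt B hs hi _ (a + b)) w =
      affineAct B hs hi ℓ (loopElt B hs hi _ a) w + affineAct B hs hi ℓ (loopElt B hs hi _ b) w
    rw [map_add, map_add, LinearMap.add_apply]
  map_smul' r a := vo_ext fun m w => by
    rw [RingHom.id_apply, mode_smul]
    change affineAct B hs hi ℓ (loopElt B hs hi _ (r • a)) w =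
      r • affineAct B hs hi ℓ (loopElt B hs hi _ a) w
    rw [map_smul, map_smul, LinearMap.smul_apply]

theorem mode_current (a : 𝔤) (m : ℤ) (w : VacuumModule B hs hi ℓ) :
    mode (current B hs hi ℓ a) m w = affineAct B hs hi ℓ (loopElt B hs hi m a) w := by
  change affineAct B hs hi ℓ (loopElt B hs hi (-(-m - 1) - 1) a) w = _
  rw [show -(-m - 1) - 1 = m by ring]

theorem current_comm (a b : 𝔤) (m n : ℤ) (w : VacuumModule B hs hi ℓ) :
    mode (current B hs hi ℓ a) m (mode (current B hs hi ℓ b) n w) -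
      mode (current B hs hi ℓ b) n (mode (current B hs hi ℓ a) m w) =
      mode (current B hs hi ℓ ⁅a, b⁆) (m + n) w +
        (if m + n = 0 then (m : ℂ) * (B a b * ℓ) else 0) • w := by
  simp only [mode_current]
  rw [affineAct_lie, lie_loopElt, map_add, map_smul, LinearMap.add_apply, LinearMap.smul_apply,
    affineAct_centralElt, smul_smul]
  congr 2
  split_ifs <;> ring

/-- The affine algebra acts on all vertex operators of the vacuum module: `a ⊗ t^n` acts as
`φ(x) ↦ a(x)_n φ(x)`, and `c` acts as `ℓ`. -/
def fieldRep : AffineLieAlgebra B hs hi →ₗ⁅ℂ⁆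
    Module.End ℂ (VertexOperator ℂ (VacuumModule B hs hi ℓ)) :=
  affineRep B hs hi (fun n => nthProduct n ∘ₗ current B hs hi ℓ) ℓ (fun m n a b => by
    ext1 φ
    have := nthProduct_comm (current B hs hi ℓ a) (current B hs hi ℓ b) (current B hs hi ℓ ⁅a, b⁆)
      (B a b * ℓ) (fun m n w => current_comm B hs hi ℓ a b m n w) m n φ
    refine this.trans ?_
    simp only [LinearMap.add_apply, LinearMap.comp_apply, LinearMap.smul_apply, Module.End.one_apply,
      smul_smul]
    congr 2
    split_ifs <;> ring)

theorem fieldRep_loopElt (n : ℤ) (a : 𝔤) (φ : VertexOperator ℂ (VacuumModule B hs hi ℓ)) :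
    fieldRep B hs hi ℓ (loopElt B hs hi n a) φ = nthProduct n (current B hs hi ℓ a) φ := by
  rw [fieldRep, affineRep_apply, affineLinearLift_loopElt]
  rfl

theorem fieldRep_centralElt (φ : VertexOperator ℂ (VacuumModule B hs hi ℓ)) :
    fieldRep B hs hi ℓ (centralElt B hs hi) φ = ℓ • φ := by
  rw [fieldRep, affineRep_apply, affineLinearLift_centralElt]
  rfl

/-- The action of `U(𝔤̂)` on the vertex operators of the vacuum module. -/
def fieldRepU : UniversalEnvelopingAlgebra ℂ (AffineLieAlgebra B hs hi) →ₐ[ℂ]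
    Module.End ℂ (VertexOperator ℂ (VacuumModule B hs hi ℓ)) :=
  UniversalEnvelopingAlgebra.lift ℂ (fieldRep B hs hi ℓ)

theorem fieldRepU_ι (x : AffineLieAlgebra B hs hi) :
    fieldRepU B hs hi ℓ (UniversalEnvelopingAlgebra.ι ℂ x) = fieldRep B hs hi ℓ x :=
  UniversalEnvelopingAlgebra.lift_ι_apply ℂ _ x

theorem fieldRepU_vacuumIdeal (u) (hu : u ∈ vacuumIdeal B hs hi ℓ) :
    fieldRepU B hs hi ℓ u idField = 0 := by
  induction hu using Submodule.span_induction with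
  | mem u hu =>
    rcases hu with ⟨n, a, rfl⟩ | hu
    · rw [fieldRepU_ι, fieldRep_loopElt, nthProduct_idField _ _ (by omega)]
    · rw [Set.mem_singleton_iff] at hu
      rw [hu, map_sub, fieldRepU_ι, LinearMap.sub_apply, fieldRep_centralElt, AlgHom.commutes,
        Module.algebraMap_end_apply, sub_self]
  | zero => simp
  | add u v _ _ hu hv => rw [map_add, LinearMap.add_apply, hu, hv, add_zero]
  | smul r u _ hu => rw [smul_eq_mul, map_mul, Module.End.mul_apply, hu, map_zero]

/-- The map `U(𝔤̂) → (vertex operators)`, `u ↦ u · 1`. -/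
def affineYU : UniversalEnvelopingAlgebra ℂ (AffineLieAlgebra B hs hi) →ₗ[ℂ]
    VertexOperator ℂ (VacuumModule B hs hi ℓ) where
  toFun u := fieldRepU B hs hi ℓ u idField
  map_add' u v := by rw [map_add, LinearMap.add_apply]
  map_smul' r u := by rw [map_smul, LinearMap.smul_apply, RingHom.id_apply]

/-- The vertex operator map `Y(·, x)` of `V_𝔤̂(ℓ, 0)`: the unique `𝔤̂`-module homomorphism into the
vertex operators with `Y(𝟏, x) = 1`, where `a ⊗ t^n` acts on vertex operators by
`φ(x) ↦ a(x)_n φ(x)`. -/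
def affineY : VacuumModule B hs hi ℓ →ₗ[ℂ] VertexOperator ℂ (VacuumModule B hs hi ℓ) :=
  Submodule.liftQ ((vacuumIdeal B hs hi ℓ).restrictScalars ℂ) (affineYU B hs hi ℓ)
    (fun u hu => fieldRepU_vacuumIdeal B hs hi ℓ u hu)

theorem affineY_toVacuumModule (u) :
    affineY B hs hi ℓ (toVacuumModule B hs hi ℓ u) = fieldRepU B hs hi ℓ u idField := rfl

/-- `Y(𝟏, x) = 1`. -/
theorem affineY_vacuum : affineY B hs hi ℓ (vacuum B hs hi ℓ) = idField := by
  rw [vacuum, affineY_toVacuumModule, map_one, Module.End.one_apply]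

/-- `Y(a(n) v, x) = a(x)_n Y(v, x)`. -/
theorem affineY_act (a : 𝔤) (n : ℤ) (v : VacuumModule B hs hi ℓ) :
    affineY B hs hi ℓ (affineAct B hs hi ℓ (loopElt B hs hi n a) v) =
      nthProduct n (current B hs hi ℓ a) (affineY B hs hi ℓ v) := by
  obtain ⟨u, rfl⟩ := toVacuumModule_surjective B hs hi ℓ v
  rw [affineAct_apply, ← map_smul, affineY_toVacuumModule, affineY_toVacuumModule, smul_eq_mul]
  rw [map_mul, fieldRepU_ι, Module.End.mul_apply, fieldRep_loopElt]

/-- `Y(a(-1)𝟏, x) = a(x) = ∑ a(n) x^(-n-1)`. -/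
theorem affineY_generator (a : 𝔤) :
    affineY B hs hi ℓ (affineAct B hs hi ℓ (loopElt B hs hi (-1) a) (vacuum B hs hi ℓ)) =
      current B hs hi ℓ a := by
  rw [affineY_act, affineY_vacuum, nthProduct_neg_one_idField]

/-- The creation property: `Y(v, x)𝟏 ∈ V[[x]]`, with constant term `v`. -/
theorem affineY_creation (v : VacuumModule B hs hi ℓ) :
    (∀ m : ℕ, mode (affineY B hs hi ℓ v) m (vacuum B hs hi ℓ) = 0) ∧
      mode (affineY B hs hi ℓ v) (-1) (vacuum B hs hi ℓ) = v := by
  induction v using vacuumModule_induction with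
  | hvac =>
    rw [affineY_vacuum]
    exact ⟨fun m => by rw [ncoeff_idField, if_neg (by omega)], by rw [ncoeff_idField, if_pos rfl]⟩
  | hadd v w hv hw =>
    rw [map_add]
    refine ⟨fun m => ?_, ?_⟩
    · rw [mode_add, hv.1, hw.1, add_zero]
    · rw [mode_add, hv.2, hw.2]
  | hsmul r v hv =>
    rw [map_smul]
    refine ⟨fun m => ?_, ?_⟩
    · rw [mode_smul, hv.1, smul_zero]
    · rw [mode_smul, hv.2]
  | hact x v hv =>
    induction x using affine_induction with
    | hl n a =>
      rw [affineY_act]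
      have h2 : ∀ i : ℕ, mode (current B hs hi ℓ a) i (vacuum B hs hi ℓ) = 0 := fun i => by
        rw [mode_current, affineAct_nonneg_vacuum]
      refine ⟨fun m => ?_, ?_⟩
      · rw [ncoeff_nthProduct, nthMode]
        simp only [h2, map_zero, smul_zero, finsum_zero, sub_zero]
        have h1 : ∀ i : ℕ, mode (affineY B hs hi ℓ v) ((m : ℤ) + i) (vacuum B hs hi ℓ) = 0 :=
          fun i => hv.1 (m + i)
        simp only [h1, map_zero, smul_zero, finsum_zero]
      · rw [ncoeff_nthProduct, nthMode]
        simp only [h2, map_zero, smul_zero, finsum_zero, sub_zero]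
        rw [finsum_eq_single _ 0]
        · simp [bp, hv.2, mode_current]
        · intro i hi'
          obtain ⟨j, rfl⟩ := Nat.exists_eq_succ_of_ne_zero hi'
          have := hv.1 j
          rw [show (-1 : ℤ) + (j.succ : ℕ) = j by push_cast; ring, this, map_zero, smul_zero]
    | hc =>
      rw [affineAct_centralElt, map_smul]
      refine ⟨fun m => ?_, ?_⟩
      · rw [mode_smul, hv.1, smul_zero]
      · rw [mode_smul, hv.2]
    | hadd x y hx hy =>
      rw [map_add, LinearMap.add_apply, map_add]
      refine ⟨fun m => ?_, ?_⟩
      · rw [mode_add, hx.1, hy.1, add_zero]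
      · rw [mode_add, hx.2, hy.2]
    | hsmul r x hx =>
      rw [map_smul, LinearMap.smul_apply, map_smul]
      refine ⟨fun m => ?_, ?_⟩
      · rw [mode_smul, hx.1, smul_zero]
      · rw [mode_smul, hx.2]

/-- The affine vertex algebra `V_𝔤̂(ℓ, 0)` of level `ℓ`. -/
def affineVertexAlgebra : VertexAlgebraData (VacuumModule B hs hi ℓ) where
  Y := affineY B hs hi ℓ
  vac := vacuum B hs hi ℓ

end Affine

end

end AffineVA

namespace AffineVA

noncomputable section

open scoped TensorProduct
open LieAlgebra LieModule

attribute [local instance] LieRing.ofAssociativeRing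

/-! ### The vacuum module realized on `U(t⁻¹𝔤[t⁻¹])`, and its vacuum functional. -/

section VacuumFunctional

/-! Filter `V(ℓ)` by the number of letters `a(-m-1)` applied to `𝟏`. To leading order each letter of
a word contributes only its creation half, so a word `u` in letters `a(-m-1)` turns `Y(u, x)` into
the product of the divided derivatives `∑ⱼ (m+j choose j) a(-m-1-j) xʲ`. Replacing each `a(-m-1)` by
a number `s(a, m)`, the leading term of `Y(u₁, x₁)⋯Y(uₙ, xₙ)𝟏` becomes a monomial in the jets, at
the points `x₁, …, xₙ`, of the polynomials `∑ⱼ s(a, j) Xʲ`. A linear relation over `K =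
ℂ((x₁))⋯((xₙ))` between such series therefore gives, in top total length, a polynomial over `K`
vanishing at the jets of all finitely supported complex sequences. It is zero: the `xᵢ` are
distinct, so Hermite interpolation realizes arbitrary jets by sequences in `K`, and values in the
infinite subset `ℂ ⊆ K` suffice to test polynomials in the coefficients
(`mvPolynomial_eq_zero_of_jets`).

Substituting numbers for letters is made rigorous without the full Poincaré–Birkhoff–Witt theorem.
The comultiplication `V(ℓ) → V(0) ⊗ V(ℓ)`, contracted with a functional `μ` on `V(0)` with `μ(𝟏) =
0`, is an operator on `V(ℓ)` that removes a letter `a(-m-1)` at the price of the scalar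
`μ(a(-m-1)𝟏)`, up to shorter words (`coact_pow_act`). Its `k`-th power over `k!`, followed by the
functional `𝟏 ↦ 1` that kills `t⁻¹𝔤[t⁻¹]V`, reads off the symbol of degree `k` (`symbolAt`).

Enough functionals `μ` come from the comultiplication `V(0) → V(1) ⊗ V(-1)`: at level `1`, the
operator `b(N+1)` pairs with `a(-N-1)𝟏` to give `(N+1)⟨b, a⟩`, and nondegeneracy of the form then
gives arbitrary values (`exists_dual`). Hence the level `ℓ` plays no role. The conclusion is
`eq_zero_of_sum_monomialSeries`, combined with the fact that unordered words in basis letters span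
(`span_word_letters`). -/

theorem universalEnvelopingAlgebra_induction {L : Type*} [LieRing L] [LieAlgebra ℂ L]
    {p : UniversalEnvelopingAlgebra ℂ L → Prop} (hone : p 1)
    (hadd : ∀ u v, p u → p v → p (u + v)) (hsmul : ∀ (r : ℂ) u, p u → p (r • u))
    (hmul : ∀ x u, p u → p (UniversalEnvelopingAlgebra.ι ℂ x * u))
    (u : UniversalEnvelopingAlgebra ℂ L) : p u := by
  suffices H : ∀ u v : UniversalEnvelopingAlgebra ℂ L, p v → p (u * v) by
    simpa using H u 1 hone
  intro u
  obtain ⟨t, rfl⟩ : ∃ t, UniversalEnvelopingAlgebra.mkAlgHom ℂ _ t = u :=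
    RingCon.mkₐ_surjective _ u
  induction t using TensorAlgebra.induction with
  | algebraMap r =>
    intro v hv
    rw [AlgHom.commutes, ← Algebra.smul_def]
    exact hsmul r v hv
  | ι x => exact fun v hv => hmul x v hv
  | mul a b ha hb =>
    intro v hv
    rw [map_mul, mul_assoc]
    exact ha _ (hb _ hv)
  | add a b ha hb =>
    intro v hv
    rw [map_add, add_mul]
    exact hadd _ _ (ha _ hv) (hb _ hv)

variable {𝔤 : Type*} [LieRing 𝔤] [LieAlgebra ℂ 𝔤] (B : LinearMap.BilinForm ℂ 𝔤)
  (hs : B.IsSymm) (hi : B.lieInvariant 𝔤) (ℓ : ℂ)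

section Lift

variable {M : Type*} [AddCommGroup M] [Module ℂ M]
  (ρ : AffineLieAlgebra B hs hi →ₗ⁅ℂ⁆ Module.End ℂ M) (m : M)

/-- The map `U(𝔤̂) → M`, `u ↦ u m`, for a representation `M` of the affine algebra. -/
def orbitMap : UniversalEnvelopingAlgebra ℂ (AffineLieAlgebra B hs hi) →ₗ[ℂ] M :=
  (LinearMap.applyₗ m) ∘ₗ (UniversalEnvelopingAlgebra.lift ℂ ρ).toLinearMap

theorem orbitMap_apply (u) :
    orbitMap B hs hi ρ m u = UniversalEnvelopingAlgebra.lift ℂ ρ u m := rfl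

/-- The annihilator of `m` is a left ideal, so it is enough to look at the generators. -/
theorem orbitMap_vacuumIdeal (h0 : ∀ (n : ℕ) a, ρ (loopElt B hs hi n a) m = 0)
    (hc : ρ (centralElt B hs hi) m = ℓ • m) (u) (hu : u ∈ vacuumIdeal B hs hi ℓ) :
    orbitMap B hs hi ρ m u = 0 := by
  rw [orbitMap_apply]
  induction hu using Submodule.span_induction with
  | mem u hu =>
    rcases hu with ⟨n, a, rfl⟩ | hu
    · rw [UniversalEnvelopingAlgebra.lift_ι_apply, h0]
    · rw [Set.mem_singleton_iff] at hu
      rw [hu, map_sub, UniversalEnvelopingAlgebra.lift_ι_apply, LinearMap.sub_apply, hc,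
        AlgHom.commutes, Module.algebraMap_end_apply, sub_self]
  | zero => simp
  | add u v _ _ hu hv => rw [map_add, LinearMap.add_apply, hu, hv, add_zero]
  | smul r u _ hu => rw [smul_eq_mul, map_mul, Module.End.mul_apply, hu, map_zero]

variable (h0 : ∀ (n : ℕ) a, ρ (loopElt B hs hi n a) m = 0)
  (hc : ρ (centralElt B hs hi) m = ℓ • m)

/-- The universal property of the vacuum module. -/
def vacuumLift : VacuumModule B hs hi ℓ →ₗ[ℂ] M :=
  Submodule.liftQ ((vacuumIdeal B hs hi ℓ).restrictScalars ℂ) (orbitMap B hs hi ρ m)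
    (fun u hu => orbitMap_vacuumIdeal B hs hi ℓ ρ m h0 hc u hu)

theorem vacuumLift_toVacuumModule (u) :
    vacuumLift B hs hi ℓ ρ m h0 hc (toVacuumModule B hs hi ℓ u) =
      UniversalEnvelopingAlgebra.lift ℂ ρ u m := rfl

theorem vacuumLift_vacuum : vacuumLift B hs hi ℓ ρ m h0 hc (vacuum B hs hi ℓ) = m := by
  rw [vacuum, vacuumLift_toVacuumModule, map_one, Module.End.one_apply]

theorem vacuumLift_act (x : AffineLieAlgebra B hs hi) (v : VacuumModule B hs hi ℓ) :
    vacuumLift B hs hi ℓ ρ m h0 hc (affineAct B hs hi ℓ x v) =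
      ρ x (vacuumLift B hs hi ℓ ρ m h0 hc v) := by
  obtain ⟨u, rfl⟩ := toVacuumModule_surjective B hs hi ℓ v
  rw [affineAct_apply, ← map_smul, vacuumLift_toVacuumModule, vacuumLift_toVacuumModule,
    smul_eq_mul, map_mul, UniversalEnvelopingAlgebra.lift_ι_apply, Module.End.mul_apply]

end Lift

/-- The projection of the affine algebra onto `t⁻¹𝔤[t⁻¹]` along `𝔤[t] ⊕ ℂ c`. -/
def negProj : AffineLieAlgebra B hs hi →ₗ[ℂ] AffineLieAlgebra B hs hi :=
  affineLinearLift B hs hi (fun n => if n < 0 then loopElt B hs hi n else 0) 0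

theorem negProj_loopElt (n : ℤ) (a : 𝔤) : negProj B hs hi (loopElt B hs hi n a) =
    if n < 0 then loopElt B hs hi n a else 0 := by
  rw [negProj, affineLinearLift_loopElt]
  split_ifs <;> rfl

theorem negProj_centralElt : negProj B hs hi (centralElt B hs hi) = 0 := by
  rw [negProj, affineLinearLift_centralElt]

/-- Two negative exponents have a negative sum, so no central term can appear. -/
theorem negProj_lie (x y : AffineLieAlgebra B hs hi) :
    negProj B hs hi ⁅negProj B hs hi x, negProj B hs hi y⁆ =
      ⁅negProj B hs hi x, negProj B hs hi y⁆ := by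
  induction x using affine_induction with
  | hc => rw [negProj_centralElt, zero_lie, map_zero]
  | hadd x y hx hy => simp only [map_add, add_lie, hx, hy]
  | hsmul r x hx => simp only [map_smul, smul_lie, hx]
  | hl m a =>
    induction y using affine_induction with
    | hc => rw [negProj_centralElt, lie_zero, map_zero]
    | hadd x y hx hy => simp only [map_add, lie_add, hx, hy]
    | hsmul r x hx => simp only [map_smul, lie_smul, hx]
    | hl n b =>
      rw [negProj_loopElt, negProj_loopElt]
      by_cases hm : m < 0
      · by_cases hn : n < 0
        · rw [if_pos hm, if_pos hn, lie_loopElt, if_neg (by omega), zero_smul, add_zero,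
            negProj_loopElt, if_pos (by omega)]
        · rw [if_neg hn, lie_zero, map_zero]
      · rw [if_neg hm, zero_lie, map_zero]

/-- The subalgebra `t⁻¹𝔤[t⁻¹]` of the affine algebra. -/
def negSub : LieSubalgebra ℂ (AffineLieAlgebra B hs hi) where
  carrier := {x | negProj B hs hi x = x}
  add_mem' {x y} hx hy := by
    rw [Set.mem_ofPred_eq] at *
    rw [map_add, hx, hy]
  zero_mem' := map_zero _
  smul_mem' c x hx := by
    rw [Set.mem_ofPred_eq] at *
    rw [map_smul, hx]
  lie_mem' {x y} hx hy := by
    change negProj B hs hi x = x at hx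
    change negProj B hs hi y = y at hy
    have := negProj_lie B hs hi x y
    rwa [hx, hy] at this

/-- The element `a ⊗ t^(-m-1)` of `t⁻¹𝔤[t⁻¹]`. -/
def negElt (m : ℕ) : 𝔤 →ₗ[ℂ] negSub B hs hi :=
  LinearMap.codRestrict (negSub B hs hi).toSubmodule (loopElt B hs hi (Int.negSucc m)) fun a => by
    change negProj B hs hi _ = _
    rw [negProj_loopElt, if_pos (Int.negSucc_lt_zero m)]

theorem coe_negElt (m : ℕ) (a : 𝔤) :
    (negElt B hs hi m a : AffineLieAlgebra B hs hi) = loopElt B hs hi (Int.negSucc m) a := rfl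

/-- The linear map `𝔤̂ → U(t⁻¹𝔤[t⁻¹])` describing the action of `𝔤̂` on the vacuum vector. -/
def actOnOne : AffineLieAlgebra B hs hi →ₗ[ℂ] UniversalEnvelopingAlgebra ℂ (negSub B hs hi) :=
  affineLinearLift B hs hi (fun n => match n with
    | Int.ofNat _ => 0
    | Int.negSucc m =>
      (UniversalEnvelopingAlgebra.ι ℂ : negSub B hs hi →ₗ⁅ℂ⁆ _).toLinearMap ∘ₗ negElt B hs hi m)
    (ℓ • 1)

theorem actOnOne_nonneg (n : ℕ) (a : 𝔤) : actOnOne B hs hi ℓ (loopElt B hs hi n a) = 0 := by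
  rw [actOnOne, affineLinearLift_loopElt]
  rfl

theorem actOnOne_negSucc (m : ℕ) (a : 𝔤) :
    actOnOne B hs hi ℓ (loopElt B hs hi (Int.negSucc m) a) =
      UniversalEnvelopingAlgebra.ι ℂ (negElt B hs hi m a) := by
  rw [actOnOne, affineLinearLift_loopElt]
  rfl

theorem actOnOne_centralElt : actOnOne B hs hi ℓ (centralElt B hs hi) = ℓ • 1 := by
  rw [actOnOne, affineLinearLift_centralElt]

/-- Phrasing the claim through the projection makes both sides linear on all of `𝔤̂`, where
`affine_induction` applies; `actOnOne_coe` is the form in which it is used. -/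
theorem actOnOne_negProj (x : AffineLieAlgebra B hs hi) (hx : negProj B hs hi x ∈ negSub B hs hi) :
    actOnOne B hs hi ℓ (negProj B hs hi x) = UniversalEnvelopingAlgebra.ι ℂ
      (⟨negProj B hs hi x, hx⟩ : negSub B hs hi) := by
  have hmem : ∀ y, negProj B hs hi y ∈ negSub B hs hi := by
    intro y
    change negProj B hs hi (negProj B hs hi y) = negProj B hs hi y
    induction y using affine_induction with
    | hc => rw [negProj_centralElt, map_zero]
    | hadd x y hx hy => simp only [map_add, hx, hy]
    | hsmul r x hx => simp only [map_smul, hx]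
    | hl n a =>
      rw [negProj_loopElt]
      split_ifs with h
      · rw [negProj_loopElt, if_pos h]
      · rw [map_zero]
  have key : actOnOne B hs hi ℓ ∘ₗ negProj B hs hi =
      (UniversalEnvelopingAlgebra.ι ℂ : negSub B hs hi →ₗ⁅ℂ⁆ _).toLinearMap ∘ₗ
        LinearMap.codRestrict (negSub B hs hi).toSubmodule (negProj B hs hi) hmem := by
    ext y
    simp only [LinearMap.comp_apply]
    induction y using affine_induction with
    | hc =>
      rw [negProj_centralElt, map_zero, eq_comm]
      convert LinearMap.map_zero _
      exact Subtype.ext (negProj_centralElt B hs hi)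
    | hadd x y hx hy => simp only [map_add, hx, hy]
    | hsmul r x hx => simp only [map_smul, hx]
    | hl n a =>
      rcases n with n | n
      · have h : negProj B hs hi (loopElt B hs hi (Int.ofNat n) a) = 0 := by
          rw [negProj_loopElt, if_neg (by simp)]
        rw [h, map_zero, eq_comm]
        convert LinearMap.map_zero _
        exact Subtype.ext h
      · have h : negProj B hs hi (loopElt B hs hi (Int.negSucc n) a) =
            loopElt B hs hi (Int.negSucc n) a := by
          rw [negProj_loopElt, if_pos (Int.negSucc_lt_zero n)]
        rw [h, actOnOne_negSucc]
        refine congrArg (UniversalEnvelopingAlgebra.ι ℂ) (Subtype.ext ?_)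
        exact h.symm
  exact LinearMap.congr_fun key x

theorem actOnOne_coe (x : negSub B hs hi) :
    actOnOne B hs hi ℓ x = UniversalEnvelopingAlgebra.ι ℂ x := by
  obtain ⟨x, hx⟩ := x
  have hx' : negProj B hs hi x = x := hx
  have := actOnOne_negProj B hs hi ℓ x (by rw [hx']; exact hx)
  simpa only [hx'] using this

/-- The action of `t⁻¹𝔤[t⁻¹]` on linear maps from `𝔤̂` to `U(t⁻¹𝔤[t⁻¹])`. -/
def homRep : negSub B hs hi →ₗ⁅ℂ⁆ Module.End ℂ
    (AffineLieAlgebra B hs hi →ₗ[ℂ] UniversalEnvelopingAlgebra ℂ (negSub B hs hi)) where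
  -- The formula is `(a · h)(x) = a h(x) - h([a, x])`. If `h` is `x ↦ x · u`, then `a · h` is `x ↦ x
  -- · (a u)`.
  toFun a := LinearMap.llcomp ℂ _ _ _ (LinearMap.mulLeft ℂ (UniversalEnvelopingAlgebra.ι ℂ a)) -
    LinearMap.lcomp ℂ _ (LieAlgebra.ad ℂ (AffineLieAlgebra B hs hi) a)
  map_add' a b := LinearMap.ext fun h => LinearMap.ext fun x => by
    simp [add_mul, -UniversalEnvelopingAlgebra.ι_apply]
    abel
  map_smul' c a := LinearMap.ext fun h => LinearMap.ext fun x => by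
    simp [smul_sub, -UniversalEnvelopingAlgebra.ι_apply]
  map_lie' {a b} := LinearMap.ext fun h => LinearMap.ext fun x => by
    simp only [LieHom.map_lie, LieRing.of_associative_ring_bracket]
    simp [sub_mul, mul_sub, mul_assoc, -UniversalEnvelopingAlgebra.ι_apply]
    abel

/-- The action of `U(t⁻¹𝔤[t⁻¹])` on linear maps from `𝔤̂` to `U(t⁻¹𝔤[t⁻¹])`. -/
def homRepU : UniversalEnvelopingAlgebra ℂ (negSub B hs hi) →ₐ[ℂ] Module.End ℂ
    (AffineLieAlgebra B hs hi →ₗ[ℂ] UniversalEnvelopingAlgebra ℂ (negSub B hs hi)) :=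
  UniversalEnvelopingAlgebra.lift ℂ (homRep B hs hi)

theorem homRepU_ι (a : negSub B hs hi) :
    homRepU B hs hi (UniversalEnvelopingAlgebra.ι ℂ a) = homRep B hs hi a :=
  UniversalEnvelopingAlgebra.lift_ι_apply ℂ _ a

theorem homRepU_mul (a : negSub B hs hi) (u) (h) (x : AffineLieAlgebra B hs hi) :
    homRepU B hs hi (UniversalEnvelopingAlgebra.ι ℂ a * u) h x =
      UniversalEnvelopingAlgebra.ι ℂ a * homRepU B hs hi u h x -
        homRepU B hs hi u h ⁅(a : AffineLieAlgebra B hs hi), x⁆ := by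
  rw [map_mul, homRepU_ι]
  rfl

/-- The action of the affine algebra on `U(t⁻¹𝔤[t⁻¹])`, realizing the vacuum module. -/
def negAct (x : AffineLieAlgebra B hs hi) :
    Module.End ℂ (UniversalEnvelopingAlgebra ℂ (negSub B hs hi)) where
  -- The action is forced by its values on `1` and by `x · (a u) = a (x · u) + [x, a] · u`. This
  -- recursion on `u` is consistent because `u` acts on `Hom(𝔤̂, U)` through an algebra map.
  toFun u := homRepU B hs hi u (actOnOne B hs hi ℓ) x
  map_add' u v := by rw [map_add, LinearMap.add_apply, LinearMap.add_apply]
  map_smul' c u := by rw [map_smul, LinearMap.smul_apply, LinearMap.smul_apply, RingHom.id_apply]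

theorem negAct_apply (x : AffineLieAlgebra B hs hi) (u) :
    negAct B hs hi ℓ x u = homRepU B hs hi u (actOnOne B hs hi ℓ) x := rfl

theorem negAct_one (x : AffineLieAlgebra B hs hi) :
    negAct B hs hi ℓ x 1 = actOnOne B hs hi ℓ x := by
  rw [negAct_apply, map_one, Module.End.one_apply]

theorem negAct_add (x y : AffineLieAlgebra B hs hi) :
    negAct B hs hi ℓ (x + y) = negAct B hs hi ℓ x + negAct B hs hi ℓ y :=
  LinearMap.ext fun u => by
    rw [LinearMap.add_apply, negAct_apply, negAct_apply, negAct_apply, map_add]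

theorem negAct_smul (r : ℂ) (x : AffineLieAlgebra B hs hi) :
    negAct B hs hi ℓ (r • x) = r • negAct B hs hi ℓ x :=
  LinearMap.ext fun u => by
    rw [LinearMap.smul_apply, negAct_apply, negAct_apply, map_smul]

theorem negAct_zero : negAct B hs hi ℓ 0 = 0 :=
  LinearMap.ext fun u => by rw [negAct_apply, map_zero, LinearMap.zero_apply]

theorem negAct_mul (x : AffineLieAlgebra B hs hi) (a : negSub B hs hi) (u) :
    negAct B hs hi ℓ x (UniversalEnvelopingAlgebra.ι ℂ a * u) =
      UniversalEnvelopingAlgebra.ι ℂ a * negAct B hs hi ℓ x u +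
        negAct B hs hi ℓ ⁅x, (a : AffineLieAlgebra B hs hi)⁆ u := by
  rw [negAct_apply, negAct_apply, negAct_apply, homRepU_mul, ← lie_skew, map_neg, sub_neg_eq_add]

/-- By the recursion, passing `x` through a letter `a` yields `a x u + [x, a] u`, which is `x a u`
in the enveloping algebra. -/
theorem negAct_coe (x : negSub B hs hi) (u) :
    negAct B hs hi ℓ x u = UniversalEnvelopingAlgebra.ι ℂ x * u := by
  induction u using universalEnvelopingAlgebra_induction generalizing x with
  | hone => rw [negAct_one, actOnOne_coe, mul_one]
  | hadd u v hu hv => rw [map_add, hu, hv, mul_add]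
  | hsmul r u hu => rw [map_smul, hu, mul_smul_comm]
  | hmul a u hu =>
    rw [negAct_mul, hu, ← LieSubalgebra.coe_bracket, hu, LieHom.map_lie,
      LieRing.of_associative_ring_bracket]
    noncomm_ring

theorem negAct_centralElt (u) : negAct B hs hi ℓ (centralElt B hs hi) u = ℓ • u := by
  induction u using universalEnvelopingAlgebra_induction with
  | hone => rw [negAct_one, actOnOne_centralElt]
  | hadd u v hu hv => rw [map_add, hu, hv, smul_add]
  | hsmul r u hu => rw [map_smul, hu, smul_comm]
  | hmul a u hu =>
    rw [negAct_mul, hu, lie_centralElt, negAct_zero, LinearMap.zero_apply, add_zero,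
      mul_smul_comm]

/-- If one of the two elements lies in `t⁻¹𝔤[t⁻¹]`, it acts by left multiplication and the relation
is the recursion `negAct_mul`. If both have nonnegative exponent, they kill `1`, and so does the
bracket. -/
theorem negAct_lie_one (x y : AffineLieAlgebra B hs hi) :
    negAct B hs hi ℓ x (negAct B hs hi ℓ y 1) - negAct B hs hi ℓ y (negAct B hs hi ℓ x 1) =
      negAct B hs hi ℓ ⁅x, y⁆ 1 := by
  induction x using affine_induction with
  | hc => rw [negAct_centralElt, negAct_centralElt, map_smul, sub_self, lie_centralElt,
      negAct_zero, LinearMap.zero_apply]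
  | hadd x y hx hy =>
    simp only [negAct_add, LinearMap.add_apply, add_lie, map_add] at *
    rw [← hx, ← hy]
    abel
  | hsmul r x hx =>
    simp only [negAct_smul, LinearMap.smul_apply, smul_lie, map_smul] at *
    rw [← hx, smul_sub]
  | hl m a =>
    induction y using affine_induction with
    | hc => rw [negAct_centralElt, negAct_centralElt, map_smul, sub_self, ← lie_skew,
        lie_centralElt, neg_zero, negAct_zero, LinearMap.zero_apply]
    | hadd x y hx hy =>
      simp only [negAct_add, LinearMap.add_apply, lie_add, map_add] at *
      rw [← hx, ← hy]
      abel
    | hsmul r x hx =>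
      simp only [negAct_smul, LinearMap.smul_apply, lie_smul, map_smul] at *
      rw [← hx, smul_sub]
    | hl n b =>
      rcases m with m | m
      · rcases n with n | n
        · simp only [Int.ofNat_eq_natCast]
          rw [negAct_one, negAct_one, actOnOne_nonneg, actOnOne_nonneg, map_zero, map_zero,
            lie_loopElt, negAct_one, map_add, ← Nat.cast_add, actOnOne_nonneg, zero_add, map_smul]
          -- The central term carries the factor `m`, and two nonnegative exponents with zero sum
          -- are both zero.
          split_ifs with h
          · rw [show m = 0 by omega]
            simp
          · simp
        · rw [← coe_negElt, negAct_coe, negAct_coe, negAct_mul]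
          abel
      · rw [← coe_negElt, negAct_coe, negAct_coe, negAct_mul, ← lie_skew, ← neg_one_smul ℂ,
          negAct_smul, LinearMap.smul_apply]
        simp

/-- The relation for `(x, y)` at `a u` follows, by the Jacobi identity, from the relations at `u`
for `(x, y)`, `(x, [y, a])` and `(y, [x, a])`. Hence the induction on `u` keeps `x` and `y` free. -/
theorem negAct_lie (x y : AffineLieAlgebra B hs hi) (u) :
    negAct B hs hi ℓ x (negAct B hs hi ℓ y u) - negAct B hs hi ℓ y (negAct B hs hi ℓ x u) =
      negAct B hs hi ℓ ⁅x, y⁆ u := by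
  induction u using universalEnvelopingAlgebra_induction generalizing x y with
  | hone => exact negAct_lie_one B hs hi ℓ x y
  | hadd u v hu hv => rw [map_add, map_add, map_add, map_add, map_add, ← hu, ← hv]; abel
  | hsmul r u hu => rw [map_smul, map_smul, map_smul, map_smul, map_smul, ← hu, smul_sub]
  | hmul a u hu =>
    have e : negAct B hs hi ℓ ⁅⁅x, y⁆, (a : AffineLieAlgebra B hs hi)⁆ u =
        negAct B hs hi ℓ ⁅x, ⁅y, (a : AffineLieAlgebra B hs hi)⁆⁆ u -
          negAct B hs hi ℓ ⁅y, ⁅x, (a : AffineLieAlgebra B hs hi)⁆⁆ u := by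
      rw [lie_lie, sub_eq_add_neg, ← neg_one_smul ℂ, negAct_add, negAct_smul,
        LinearMap.add_apply, LinearMap.smul_apply, neg_one_smul, ← sub_eq_add_neg]
    simp only [negAct_mul, map_add]
    rw [e, ← hu x y, ← hu x ⁅y, (a : AffineLieAlgebra B hs hi)⁆,
      ← hu y ⁅x, (a : AffineLieAlgebra B hs hi)⁆, mul_sub]
    abel

/-- The affine algebra acts on `U(t⁻¹𝔤[t⁻¹])`. -/
def negRep : AffineLieAlgebra B hs hi →ₗ⁅ℂ⁆
    Module.End ℂ (UniversalEnvelopingAlgebra ℂ (negSub B hs hi)) where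
  toFun := negAct B hs hi ℓ
  map_add' := negAct_add B hs hi ℓ
  map_smul' := negAct_smul B hs hi ℓ
  map_lie' {x y} := LinearMap.ext fun u => (negAct_lie B hs hi ℓ x y u).symm

theorem negRep_apply (x : AffineLieAlgebra B hs hi) :
    negRep B hs hi ℓ x = negAct B hs hi ℓ x := rfl

/-- The `𝔤̂`-module map from the vacuum module to `U(t⁻¹𝔤[t⁻¹])` with `𝟏 ↦ 1`. -/
def toNeg : VacuumModule B hs hi ℓ →ₗ[ℂ] UniversalEnvelopingAlgebra ℂ (negSub B hs hi) :=
  vacuumLift B hs hi ℓ (negRep B hs hi ℓ) 1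
    (fun n a => by rw [negRep_apply, negAct_one, actOnOne_nonneg])
    (by rw [negRep_apply, negAct_centralElt])

/-- The functional on the vacuum module killing `t⁻¹𝔤[t⁻¹] V` and taking the value `1` on `𝟏`. -/
def vacuumFunctional : Module.Dual ℂ (VacuumModule B hs hi ℓ) :=
  -- The lift of the zero representation is the augmentation of `U(t⁻¹𝔤[t⁻¹])`.
  (UniversalEnvelopingAlgebra.lift ℂ (0 : negSub B hs hi →ₗ⁅ℂ⁆ ℂ)).toLinearMap ∘ₗ
    toNeg B hs hi ℓ

theorem vacuumFunctional_vacuum : vacuumFunctional B hs hi ℓ (vacuum B hs hi ℓ) = 1 := by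
  rw [vacuumFunctional, LinearMap.comp_apply, toNeg, vacuumLift_vacuum, AlgHom.toLinearMap_apply,
    map_one]

theorem vacuumFunctional_negSucc (m : ℕ) (a : 𝔤) (v : VacuumModule B hs hi ℓ) :
    vacuumFunctional B hs hi ℓ
      (affineAct B hs hi ℓ (loopElt B hs hi (Int.negSucc m) a) v) = 0 := by
  rw [vacuumFunctional, LinearMap.comp_apply, toNeg, vacuumLift_act, negRep_apply,
    ← coe_negElt, negAct_coe, AlgHom.toLinearMap_apply, map_mul, UniversalEnvelopingAlgebra.lift_ι_apply]
  simp

end VacuumFunctional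

/-! ### Comultiplications between levels, and functionals on `V(0)` with prescribed values. -/

section Derivations

variable {𝔤 : Type*} [LieRing 𝔤] [LieAlgebra ℂ 𝔤] (B : LinearMap.BilinForm ℂ 𝔤)
  (hs : B.IsSymm) (hi : B.lieInvariant 𝔤) (ℓ₁ ℓ₂ : ℂ)

/-- The action of the affine algebra on `Hom(V(ℓ₁)*, V(ℓ₂))`. -/
def dualHomAct (x : AffineLieAlgebra B hs hi) : Module.End ℂ
    (Module.Dual ℂ (VacuumModule B hs hi ℓ₁) →ₗ[ℂ] VacuumModule B hs hi ℓ₂) where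
  -- Here `h` stands for a tensor in `V(ℓ₁) ⊗ V(ℓ₂)`, seen as a map out of the dual of the first
  -- factor. The action is the diagonal one, so the transpose enters with a plus sign and the levels
  -- add.
  toFun h := affineAct B hs hi ℓ₂ x ∘ₗ h + h ∘ₗ (affineAct B hs hi ℓ₁ x).dualMap
  map_add' h k := by rw [LinearMap.comp_add, LinearMap.add_comp]; abel
  map_smul' c h := by
    rw [LinearMap.comp_smul, LinearMap.smul_comp, RingHom.id_apply, smul_add]

theorem dualHomAct_apply (x : AffineLieAlgebra B hs hi)
    (h : Module.Dual ℂ (VacuumModule B hs hi ℓ₁) →ₗ[ℂ] VacuumModule B hs hi ℓ₂) (μ) :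
    dualHomAct B hs hi ℓ₁ ℓ₂ x h μ =
      affineAct B hs hi ℓ₂ x (h μ) + h (μ ∘ₗ affineAct B hs hi ℓ₁ x) := rfl

/-- The representation of the affine algebra on `Hom(V(ℓ₁)*, V(ℓ₂))`. -/
def dualHomRep : AffineLieAlgebra B hs hi →ₗ⁅ℂ⁆ Module.End ℂ
    (Module.Dual ℂ (VacuumModule B hs hi ℓ₁) →ₗ[ℂ] VacuumModule B hs hi ℓ₂) where
  toFun := dualHomAct B hs hi ℓ₁ ℓ₂
  map_add' x y := LinearMap.ext fun h => LinearMap.ext fun μ => by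
    rw [LinearMap.add_apply, LinearMap.add_apply]
    simp only [dualHomAct_apply]
    rw [map_add, map_add, LinearMap.comp_add, map_add, LinearMap.add_apply]
    abel
  map_smul' c x := LinearMap.ext fun h => LinearMap.ext fun μ => by
    rw [RingHom.id_apply, LinearMap.smul_apply, LinearMap.smul_apply]
    simp only [dualHomAct_apply]
    rw [map_smul, map_smul, LinearMap.comp_smul, map_smul, LinearMap.smul_apply, smul_add]
  map_lie' {x y} := LinearMap.ext fun h => LinearMap.ext fun μ => by
    have e : μ ∘ₗ affineAct B hs hi ℓ₁ ⁅x, y⁆ =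
        (μ ∘ₗ affineAct B hs hi ℓ₁ x) ∘ₗ affineAct B hs hi ℓ₁ y -
          (μ ∘ₗ affineAct B hs hi ℓ₁ y) ∘ₗ affineAct B hs hi ℓ₁ x := by
      ext v
      simp only [LinearMap.sub_apply, LinearMap.comp_apply]
      rw [← affineAct_lie, map_sub]
    rw [LieRing.of_associative_ring_bracket, LinearMap.sub_apply, LinearMap.sub_apply,
      Module.End.mul_apply, Module.End.mul_apply]
    simp only [dualHomAct_apply]
    rw [← affineAct_lie, e, map_sub]
    simp only [map_add]
    abel

theorem dualHomRep_apply (x : AffineLieAlgebra B hs hi) :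
    dualHomRep B hs hi ℓ₁ ℓ₂ x = dualHomAct B hs hi ℓ₁ ℓ₂ x := rfl

variable (ℓ : ℂ) (hℓ : ℓ₁ + ℓ₂ = ℓ)

/-- The contraction `V(ℓ₁ + ℓ₂) → Hom(V(ℓ₁)*, V(ℓ₂))` of the comultiplication
`V(ℓ₁ + ℓ₂) → V(ℓ₁) ⊗ V(ℓ₂)`. -/
def contract : VacuumModule B hs hi ℓ →ₗ[ℂ]
    Module.Dual ℂ (VacuumModule B hs hi ℓ₁) →ₗ[ℂ] VacuumModule B hs hi ℓ₂ :=
  vacuumLift B hs hi ℓ (dualHomRep B hs hi ℓ₁ ℓ₂)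
    ((LinearMap.toSpanSingleton ℂ _ (vacuum B hs hi ℓ₂)) ∘ₗ
      Module.Dual.eval ℂ _ (vacuum B hs hi ℓ₁))
    (fun n a => LinearMap.ext fun μ => by
      rw [dualHomRep_apply, dualHomAct_apply]
      simp [affineAct_nonneg_vacuum])
    (LinearMap.ext fun μ => by
      rw [dualHomRep_apply, dualHomAct_apply, affineAct_centralElt]
      simp [affineAct_centralElt, ← hℓ, add_smul, mul_smul]
      rw [add_comm])

/-- The operator `V(ℓ₁ + ℓ₂) → V(ℓ₂)` obtained from the comultiplication by applying a functional
to the factor `V(ℓ₁)`. -/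
def contractBy (μ : Module.Dual ℂ (VacuumModule B hs hi ℓ₁)) :
    VacuumModule B hs hi ℓ →ₗ[ℂ] VacuumModule B hs hi ℓ₂ :=
  LinearMap.applyₗ μ ∘ₗ contract B hs hi ℓ₁ ℓ₂ ℓ hℓ

theorem contractBy_vacuum (μ : Module.Dual ℂ (VacuumModule B hs hi ℓ₁)) :
    contractBy B hs hi ℓ₁ ℓ₂ ℓ hℓ μ (vacuum B hs hi ℓ) =
      μ (vacuum B hs hi ℓ₁) • vacuum B hs hi ℓ₂ := by
  rw [contractBy, LinearMap.comp_apply, contract, vacuumLift_vacuum]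
  rfl

theorem contractBy_act (μ : Module.Dual ℂ (VacuumModule B hs hi ℓ₁))
    (x : AffineLieAlgebra B hs hi) (v : VacuumModule B hs hi ℓ) :
    contractBy B hs hi ℓ₁ ℓ₂ ℓ hℓ μ (affineAct B hs hi ℓ x v) =
      affineAct B hs hi ℓ₂ x (contractBy B hs hi ℓ₁ ℓ₂ ℓ hℓ μ v) +
        contractBy B hs hi ℓ₁ ℓ₂ ℓ hℓ (μ ∘ₗ affineAct B hs hi ℓ₁ x) v := by
  rw [contractBy, LinearMap.comp_apply, contract, vacuumLift_act, dualHomRep_apply]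
  exact dualHomAct_apply B hs hi ℓ₁ ℓ₂ x _ μ

/-- A functional on `V(0)` killing the vacuum, with prescribed values on one mode. -/
theorem exists_dual_single (N : ℕ) (b : 𝔤) : ∃ μ : Module.Dual ℂ (VacuumModule B hs hi 0),
    μ (vacuum B hs hi 0) = 0 ∧ ∀ (m : ℕ) (a : 𝔤),
      μ (affineAct B hs hi 0 (loopElt B hs hi (Int.negSucc m) a) (vacuum B hs hi 0)) =
        if m = N then ((N : ℂ) + 1) * B b a else 0 := by
  have hb : affineAct B hs hi 1 (loopElt B hs hi ((N : ℤ) + 1) b) (vacuum B hs hi 1) = 0 := by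
    have := affineAct_nonneg_vacuum B hs hi 1 (N + 1) b
    push_cast at this
    exact this
  -- Splitting `0 = 1 + (-1)` gives a factor on which `c` acts by `1`, so that `b(N+1) a(-m-1)𝟏`
  -- sees the form.
  refine ⟨vacuumFunctional B hs hi (-1) ∘ₗ contractBy B hs hi 1 (-1) 0 (by norm_num)
    (vacuumFunctional B hs hi 1 ∘ₗ affineAct B hs hi 1 (loopElt B hs hi (N + 1 : ℤ) b)), ?_, ?_⟩
  · rw [LinearMap.comp_apply, contractBy_vacuum, LinearMap.comp_apply, hb, map_zero, zero_smul,
      map_zero]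
  · intro m a
    rw [LinearMap.comp_apply, contractBy_act, contractBy_vacuum, contractBy_vacuum, map_add,
      LinearMap.comp_apply, hb, map_zero, zero_smul, map_zero, map_zero, zero_add, map_smul,
      vacuumFunctional_vacuum, smul_eq_mul, mul_one, LinearMap.comp_apply, LinearMap.comp_apply]
    have h := affineAct_lie B hs hi 1 (loopElt B hs hi (N + 1 : ℤ) b)
      (loopElt B hs hi (Int.negSucc m) a) (vacuum B hs hi 1)
    rw [hb, map_zero, sub_zero] at h
    rw [h, lie_loopElt, map_add, LinearMap.add_apply, map_smul, LinearMap.smul_apply,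
      affineAct_centralElt, one_smul, map_add, map_smul, vacuumFunctional_vacuum, smul_eq_mul,
      mul_one, Int.negSucc_eq]
    -- The bracket term contributes nothing: with nonnegative exponent it kills `𝟏`, with negative
    -- exponent its image is killed by the functional.
    have h1 : vacuumFunctional B hs hi 1 (affineAct B hs hi 1
        (loopElt B hs hi (N + 1 + -((m : ℤ) + 1)) ⁅b, a⁆) (vacuum B hs hi 1)) = 0 := by
      rcases h2 : (N + 1 + -((m : ℤ) + 1)) with k | k
      · rw [Int.ofNat_eq_natCast, affineAct_nonneg_vacuum, map_zero]
      · rw [vacuumFunctional_negSucc]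
    rw [h1, zero_add]
    by_cases hm : m = N
    · rw [if_pos (by omega), if_pos hm]
      push_cast
      rfl
    · rw [if_neg (by omega), if_neg hm]

/-- If the evaluations `b ↦ (⟨b, e a⟩)ₐ` were not onto, a linear form vanishing on the range would
produce a combination of the `e a` orthogonal to everything. It is zero by nondegeneracy, so by
independence the form is zero. -/
theorem exists_dual_apply_eq (hB : B.Nondegenerate) {I : Type*} (e : I → 𝔤)
    (he : LinearIndependent ℂ e) (A : Finset I) (s : I → ℂ) :
    ∃ b : 𝔤, ∀ a ∈ A, B b (e a) = s a := by
  classical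
  let T : 𝔤 →ₗ[ℂ] (A → ℂ) := LinearMap.pi fun a => B.flip (e a)
  have hT : LinearMap.range T = ⊤ := by
    by_contra hne
    obtain ⟨f, hf, hf'⟩ := Submodule.exists_dual_map_eq_bot_of_lt_top
      (lt_top_iff_ne_top.2 hne) inferInstance
    apply hf
    have h1 : ∀ b, f (T b) = 0 := fun b => by
      have : f (T b) ∈ (LinearMap.range T).map f := ⟨_, ⟨b, rfl⟩, rfl⟩
      rw [hf'] at this
      simpa using this
    have h2 : ∀ w : A → ℂ, f w = ∑ a, w a * f (Pi.single a 1) := fun w => by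
      conv_lhs => rw [← Finset.univ_sum_single w, map_sum]
      refine Finset.sum_congr rfl fun a _ => ?_
      rw [← smul_eq_mul, ← map_smul, ← Pi.single_smul, smul_eq_mul, mul_one]
    have h3 : ∑ a : A, f (Pi.single a 1) • e a = 0 := by
      refine hB.2 _ fun b => ?_
      rw [map_sum]
      have := h1 b
      rw [h2] at this
      simpa [T, mul_comm] using this
    have h4 := Fintype.linearIndependent_iff.1 (he.comp (fun a : A => (a : I))
      Subtype.val_injective) _ h3
    refine LinearMap.ext fun w => ?_
    rw [h2, LinearMap.zero_apply]
    exact Finset.sum_eq_zero fun a _ => by rw [h4 a, mul_zero]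
  obtain ⟨b, hb⟩ := LinearMap.range_eq_top.1 hT fun a => s a
  exact ⟨b, fun a ha => congrFun hb ⟨a, ha⟩⟩

/-- Functionals on `V(0)` killing the vacuum take arbitrary values on `t⁻¹𝔤[t⁻¹]𝟏`. -/
theorem exists_dual (hB : B.Nondegenerate) {I : Type*} (e : I → 𝔤)
    (he : LinearIndependent ℂ e) (A : Finset I) (s : I → ℕ → ℂ) (J : ℕ) :
    ∃ μ : Module.Dual ℂ (VacuumModule B hs hi 0),
      μ (vacuum B hs hi 0) = 0 ∧ ∀ (m : ℕ), (J ≤ m → ∀ a,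
        μ (affineAct B hs hi 0 (loopElt B hs hi (Int.negSucc m) a) (vacuum B hs hi 0)) = 0) ∧
        ∀ a ∈ A, m < J →
        μ (affineAct B hs hi 0 (loopElt B hs hi (Int.negSucc m) (e a)) (vacuum B hs hi 0)) =
          s a m := by
  -- Dividing by `m + 1` compensates the factor `N + 1` of `exists_dual_single`.
  choose b hb using fun m : ℕ => exists_dual_apply_eq B hB e he A fun a => s a m / ((m : ℂ) + 1)
  choose μ hμ hμ' using fun N : ℕ => exists_dual_single B hs hi N (b N)
  refine ⟨∑ N ∈ Finset.range J, μ N, by simp [hμ], fun m => ⟨fun hm a => ?_, fun a ha hm => ?_⟩⟩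
  · rw [LinearMap.sum_apply]
    refine Finset.sum_eq_zero fun N hN => ?_
    rw [hμ', if_neg (by have := Finset.mem_range.1 hN; omega)]
  · rw [LinearMap.sum_apply, Finset.sum_eq_single m]
    · rw [hμ', if_pos rfl, hb m a ha, mul_div_cancel₀]
      exact Nat.cast_add_one_ne_zero m
    · intro N _ hN
      rw [hμ', if_neg hN.symm]
    · intro h
      exact absurd (Finset.mem_range.2 hm) h

end Derivations

/-! ### The word filtration, the coaction operators and symbols. -/

section Filtration

variable {𝔤 : Type*} [LieRing 𝔤] [LieAlgebra ℂ 𝔤] (B : LinearMap.BilinForm ℂ 𝔤)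
  (hs : B.IsSymm) (hi : B.lieInvariant 𝔤) (ℓ : ℂ)

/-- The span of the vectors `a₁(-m₁-1)⋯aᵣ(-mᵣ-1)𝟏` with `r < k`. -/
def wordFilt : ℕ → Submodule ℂ (VacuumModule B hs hi ℓ)
  | 0 => ⊥
  | k + 1 => Submodule.span ℂ ({vacuum B hs hi ℓ} ∪
      {w | ∃ (m : ℕ) (a : 𝔤), ∃ v ∈ wordFilt k,
        w = affineAct B hs hi ℓ (loopElt B hs hi (Int.negSucc m) a) v})

theorem vacuum_mem_wordFilt (k : ℕ) : vacuum B hs hi ℓ ∈ wordFilt B hs hi ℓ (k + 1) :=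
  Submodule.subset_span (Or.inl rfl)

theorem negSucc_mem_wordFilt {k : ℕ} {v} (hv : v ∈ wordFilt B hs hi ℓ k) (m : ℕ) (a : 𝔤) :
    affineAct B hs hi ℓ (loopElt B hs hi (Int.negSucc m) a) v ∈ wordFilt B hs hi ℓ (k + 1) :=
  Submodule.subset_span (Or.inr ⟨m, a, v, hv, rfl⟩)

/-- Induction principle for the pieces of the word filtration. -/
theorem wordFilt_induction {p : ℕ → VacuumModule B hs hi ℓ → Prop}
    (hvac : ∀ k, p (k + 1) (vacuum B hs hi ℓ))
    (hzero : ∀ k, p k 0)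
    (hadd : ∀ k v w, p k v → p k w → p k (v + w))
    (hsmul : ∀ k (r : ℂ) v, p k v → p k (r • v))
    (hact : ∀ k m a v, v ∈ wordFilt B hs hi ℓ k → p k v →
      p (k + 1) (affineAct B hs hi ℓ (loopElt B hs hi (Int.negSucc m) a) v))
    (k : ℕ) (v) (hv : v ∈ wordFilt B hs hi ℓ k) : p k v := by
  induction k generalizing v with
  | zero =>
    rw [wordFilt, Submodule.mem_bot] at hv
    rw [hv]
    exact hzero 0
  | succ k ih =>
    rw [wordFilt] at hv
    induction hv using Submodule.span_induction with
    | mem u hu =>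
      rcases hu with hu | ⟨m, a, w, hw, rfl⟩
      · rw [Set.mem_singleton_iff] at hu
        rw [hu]
        exact hvac k
      · exact hact k m a w hw (ih w hw)
    | zero => exact hzero _
    | add u v _ _ hu hv => exact hadd _ _ _ hu hv
    | smul r u _ hu => exact hsmul _ _ _ hu

theorem wordFilt_le_succ (k : ℕ) : wordFilt B hs hi ℓ k ≤ wordFilt B hs hi ℓ (k + 1) := by
  intro v hv
  refine wordFilt_induction B hs hi ℓ (p := fun k v => v ∈ wordFilt B hs hi ℓ (k + 1))
    (fun k => vacuum_mem_wordFilt B hs hi ℓ _) (fun k => zero_mem _)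
    (fun k v w hv hw => add_mem hv hw) (fun k r v hv => Submodule.smul_mem _ r hv)
    (fun k m a v _ hv => negSucc_mem_wordFilt B hs hi ℓ hv m a) k v hv

theorem wordFilt_mono : Monotone (wordFilt B hs hi ℓ) :=
  monotone_nat_of_le_succ (wordFilt_le_succ B hs hi ℓ)

/-- Commuting `a(n)` to the right past a letter replaces that letter by a single mode of the bracket
or by a scalar, so the length never grows. At the end `a(n)` kills `𝟏`. -/
theorem nonneg_mem_wordFilt {k : ℕ} {v} (hv : v ∈ wordFilt B hs hi ℓ k) (n : ℕ) (a : 𝔤) :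
    affineAct B hs hi ℓ (loopElt B hs hi n a) v ∈ wordFilt B hs hi ℓ k := by
  refine wordFilt_induction B hs hi ℓ
    (p := fun k v => ∀ (n : ℕ) (a : 𝔤), affineAct B hs hi ℓ (loopElt B hs hi n a) v ∈
      wordFilt B hs hi ℓ k) ?_ ?_ ?_ ?_ ?_ k v hv n a
  · intro k n a
    rw [affineAct_nonneg_vacuum]
    exact zero_mem _
  · intro k n a
    rw [map_zero]
    exact zero_mem _
  · intro k v w hv hw n a
    rw [map_add]
    exact add_mem (hv n a) (hw n a)
  · intro k r v hv n a
    rw [map_smul]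
    exact Submodule.smul_mem _ r (hv n a)
  · intro k m b v hv ih n a
    have h := affineAct_lie B hs hi ℓ (loopElt B hs hi n a)
      (loopElt B hs hi (Int.negSucc m) b) v
    rw [sub_eq_iff_eq_add] at h
    rw [h, lie_loopElt, map_add, LinearMap.add_apply, map_smul, LinearMap.smul_apply,
      affineAct_centralElt]
    refine add_mem (add_mem ?_ ?_) (negSucc_mem_wordFilt B hs hi ℓ (ih n a) m b)
    · rcases (n : ℤ) + Int.negSucc m with j | j
      · exact wordFilt_le_succ B hs hi ℓ k (ih j _)
      · exact negSucc_mem_wordFilt B hs hi ℓ hv j _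
    · exact Submodule.smul_mem _ _ (Submodule.smul_mem _ _ (wordFilt_le_succ B hs hi ℓ k hv))

theorem loopElt_mem_wordFilt {k : ℕ} {v} (hv : v ∈ wordFilt B hs hi ℓ k) (n : ℤ) (a : 𝔤) :
    affineAct B hs hi ℓ (loopElt B hs hi n a) v ∈ wordFilt B hs hi ℓ (k + 1) := by
  rcases n with n | n
  · exact wordFilt_le_succ B hs hi ℓ k (nonneg_mem_wordFilt B hs hi ℓ hv n a)
  · exact negSucc_mem_wordFilt B hs hi ℓ hv n a

theorem exists_mem_wordFilt (v : VacuumModule B hs hi ℓ) : ∃ k, v ∈ wordFilt B hs hi ℓ k := by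
  induction v using vacuumModule_induction with
  | hvac => exact ⟨1, vacuum_mem_wordFilt B hs hi ℓ 0⟩
  | hadd v w hv hw =>
    obtain ⟨k, hk⟩ := hv
    obtain ⟨l, hl⟩ := hw
    exact ⟨max k l, add_mem (wordFilt_mono B hs hi ℓ (le_max_left k l) hk)
      (wordFilt_mono B hs hi ℓ (le_max_right k l) hl)⟩
  | hsmul r v hv =>
    obtain ⟨k, hk⟩ := hv
    exact ⟨k, Submodule.smul_mem _ r hk⟩
  | hact x v hv =>
    obtain ⟨k, hk⟩ := hv
    refine ⟨k + 1, ?_⟩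
    induction x using affine_induction with
    | hc =>
      rw [affineAct_centralElt]
      exact Submodule.smul_mem _ _ (wordFilt_le_succ B hs hi ℓ k hk)
    | hl n a => exact loopElt_mem_wordFilt B hs hi ℓ hk n a
    | hadd x y hx hy =>
      rw [map_add, LinearMap.add_apply]
      exact add_mem hx hy
    | hsmul r x hx =>
      rw [map_smul, LinearMap.smul_apply]
      exact Submodule.smul_mem _ r hx

/-- The operator on `V(ℓ)` obtained from the coaction `V(ℓ) → V(0) ⊗ V(ℓ)` by applying a
functional to the factor `V(0)`. -/
def coact (μ : Module.Dual ℂ (VacuumModule B hs hi 0)) : Module.End ℂ (VacuumModule B hs hi ℓ) :=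
  contractBy B hs hi 0 ℓ ℓ (zero_add ℓ) μ

theorem coact_vacuum (μ : Module.Dual ℂ (VacuumModule B hs hi 0)) :
    coact B hs hi ℓ μ (vacuum B hs hi ℓ) = μ (vacuum B hs hi 0) • vacuum B hs hi ℓ :=
  contractBy_vacuum B hs hi 0 ℓ ℓ (zero_add ℓ) μ

theorem coact_act (μ : Module.Dual ℂ (VacuumModule B hs hi 0))
    (x : AffineLieAlgebra B hs hi) (v : VacuumModule B hs hi ℓ) :
    coact B hs hi ℓ μ (affineAct B hs hi ℓ x v) =
      affineAct B hs hi ℓ x (coact B hs hi ℓ μ v) +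
        coact B hs hi ℓ (μ ∘ₗ affineAct B hs hi 0 x) v :=
  contractBy_act B hs hi 0 ℓ ℓ (zero_add ℓ) μ x v

/-- By `coact_act`, each letter is either kept or absorbed into the functional. -/
theorem coact_mem_wordFilt {k : ℕ} {v} (hv : v ∈ wordFilt B hs hi ℓ k)
    (μ : Module.Dual ℂ (VacuumModule B hs hi 0)) :
    coact B hs hi ℓ μ v ∈ wordFilt B hs hi ℓ k := by
  refine wordFilt_induction B hs hi ℓ
    (p := fun k v => ∀ μ, coact B hs hi ℓ μ v ∈ wordFilt B hs hi ℓ k) ?_ ?_ ?_ ?_ ?_ k v hv μ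
  · intro k μ
    rw [coact_vacuum]
    exact Submodule.smul_mem _ _ (vacuum_mem_wordFilt B hs hi ℓ k)
  · intro k μ
    rw [map_zero]
    exact zero_mem _
  · intro k v w hv hw μ
    rw [map_add]
    exact add_mem (hv μ) (hw μ)
  · intro k r v hv μ
    rw [map_smul]
    exact Submodule.smul_mem _ r (hv μ)
  · intro k m a v hv ih μ
    rw [coact_act]
    exact add_mem (negSucc_mem_wordFilt B hs hi ℓ (ih μ) m a)
      (wordFilt_le_succ B hs hi ℓ k (ih _))

/-- Only the term in which no letter is absorbed has full length, and its coefficient is `μ(𝟏)`. So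
`coact μ` strictly lowers the filtration when `μ(𝟏) = 0`. -/
theorem coact_sub_mem_wordFilt {k : ℕ} {v} (hv : v ∈ wordFilt B hs hi ℓ (k + 1))
    (μ : Module.Dual ℂ (VacuumModule B hs hi 0)) :
    coact B hs hi ℓ μ v - μ (vacuum B hs hi 0) • v ∈ wordFilt B hs hi ℓ k := by
  -- The subtraction `k - 1` is truncated; at `k = 0` only the zero vector is concerned.
  refine wordFilt_induction B hs hi ℓ
    (p := fun k v => ∀ μ, coact B hs hi ℓ μ v - μ (vacuum B hs hi 0) • v ∈
      wordFilt B hs hi ℓ (k - 1)) ?_ ?_ ?_ ?_ ?_ (k + 1) v hv μ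
  · intro k μ
    rw [coact_vacuum, sub_self]
    exact zero_mem _
  · intro k μ
    rw [map_zero, smul_zero, sub_self]
    exact zero_mem _
  · intro k v w hv hw μ
    rw [map_add, smul_add, add_sub_add_comm]
    exact add_mem (hv μ) (hw μ)
  · intro k r v hv μ
    rw [map_smul, smul_comm, ← smul_sub]
    exact Submodule.smul_mem _ r (hv μ)
  · intro k m a v hv ih μ
    rw [coact_act, add_sub_right_comm, ← map_smul, ← map_sub, Nat.add_sub_cancel]
    refine add_mem ?_ (coact_mem_wordFilt B hs hi ℓ hv _)
    rcases k with _ | k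
    · rw [wordFilt, Submodule.mem_bot] at hv
      rw [hv]
      simp
    · exact negSucc_mem_wordFilt B hs hi ℓ (ih μ) m a

theorem coact_mem_wordFilt_of_vacuum {k : ℕ} {v} (hv : v ∈ wordFilt B hs hi ℓ (k + 1))
    (μ : Module.Dual ℂ (VacuumModule B hs hi 0)) (hμ : μ (vacuum B hs hi 0) = 0) :
    coact B hs hi ℓ μ v ∈ wordFilt B hs hi ℓ k := by
  simpa [hμ] using coact_sub_mem_wordFilt B hs hi ℓ hv μ

theorem coact_pow_eq_zero {k : ℕ} {v} (hv : v ∈ wordFilt B hs hi ℓ k)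
    (μ : Module.Dual ℂ (VacuumModule B hs hi 0)) (hμ : μ (vacuum B hs hi 0) = 0) :
    (coact B hs hi ℓ μ ^ k) v = 0 := by
  induction k generalizing v with
  | zero =>
    rw [wordFilt, Submodule.mem_bot] at hv
    rw [hv, map_zero]
  | succ k ih =>
    rw [pow_succ, Module.End.mul_apply]
    exact ih (coact_mem_wordFilt_of_vacuum B hs hi ℓ hv μ hμ)

/-- In leading order `coact μ` behaves as a derivation sending a letter to its `μ`-value. The factor
`k + 1` counts which of the `k + 1` copies of `coact μ` absorbs the outer letter. -/
theorem coact_pow_act {k : ℕ} {v} (hv : v ∈ wordFilt B hs hi ℓ (k + 1))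
    (μ : Module.Dual ℂ (VacuumModule B hs hi 0)) (hμ : μ (vacuum B hs hi 0) = 0)
    (m : ℕ) (a : 𝔤) :
    (coact B hs hi ℓ μ ^ (k + 1))
        (affineAct B hs hi ℓ (loopElt B hs hi (Int.negSucc m) a) v) =
      (((k : ℂ) + 1) * μ (affineAct B hs hi 0 (loopElt B hs hi (Int.negSucc m) a)
        (vacuum B hs hi 0))) • (coact B hs hi ℓ μ ^ k) v := by
  set y := loopElt B hs hi (Int.negSucc m) a with hy
  -- When the letter `y` is absorbed, `μ ∘ y` acts by its value at `𝟏` up to vectors of shorter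
  -- length, which the remaining `k` applications kill.
  have key : ∀ k v, v ∈ wordFilt B hs hi ℓ (k + 1) →
      (coact B hs hi ℓ μ ^ k) (coact B hs hi ℓ (μ ∘ₗ affineAct B hs hi 0 y) v) =
        μ (affineAct B hs hi 0 y (vacuum B hs hi 0)) • (coact B hs hi ℓ μ ^ k) v := by
    intro k v hv
    have h := coact_pow_eq_zero B hs hi ℓ
      (coact_sub_mem_wordFilt B hs hi ℓ hv (μ ∘ₗ affineAct B hs hi 0 y)) μ hμ
    rw [map_sub, sub_eq_zero, map_smul] at h
    exact h
  induction k generalizing v with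
  | zero =>
    rw [pow_succ, Module.End.mul_apply, coact_act, map_add, key 0 v hv]
    have h := coact_mem_wordFilt_of_vacuum B hs hi ℓ hv μ hμ
    rw [wordFilt, Submodule.mem_bot] at h
    rw [h, map_zero, map_zero, zero_add]
    simp
  | succ k ih =>
    rw [pow_succ, Module.End.mul_apply, coact_act, map_add, key _ v hv,
      ih (coact_mem_wordFilt_of_vacuum B hs hi ℓ hv μ hμ), pow_succ _ k, Module.End.mul_apply,
      ← add_smul]
    congr 1
    push_cast
    ring

/-- The symbol of degree `k`, evaluated at the functional `μ`. -/
def symbolAt (μ : Module.Dual ℂ (VacuumModule B hs hi 0)) (k : ℕ) :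
    Module.Dual ℂ (VacuumModule B hs hi ℓ) :=
  -- On a word of `k` letters the `k`-th power gives `k!` times the product of the letter values.
  ((k.factorial : ℂ)⁻¹) • (vacuumFunctional B hs hi ℓ ∘ₗ coact B hs hi ℓ μ ^ k)

theorem symbolAt_vacuum (μ : Module.Dual ℂ (VacuumModule B hs hi 0)) :
    symbolAt B hs hi ℓ μ 0 (vacuum B hs hi ℓ) = 1 := by
  simp [symbolAt, vacuumFunctional_vacuum]

theorem symbolAt_eq_zero (μ : Module.Dual ℂ (VacuumModule B hs hi 0))
    (hμ : μ (vacuum B hs hi 0) = 0) {k : ℕ} {v} (hv : v ∈ wordFilt B hs hi ℓ k) :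
    symbolAt B hs hi ℓ μ k v = 0 := by
  rw [symbolAt, LinearMap.smul_apply, LinearMap.comp_apply,
    coact_pow_eq_zero B hs hi ℓ hv μ hμ, map_zero, smul_zero]

/-- The normalization by `k!` cancels the factor `k + 1` of `coact_pow_act`, which makes symbols
multiplicative in the letters. -/
theorem symbolAt_act (μ : Module.Dual ℂ (VacuumModule B hs hi 0))
    (hμ : μ (vacuum B hs hi 0) = 0) {k : ℕ} {v} (hv : v ∈ wordFilt B hs hi ℓ (k + 1))
    (m : ℕ) (a : 𝔤) :
    symbolAt B hs hi ℓ μ (k + 1)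
        (affineAct B hs hi ℓ (loopElt B hs hi (Int.negSucc m) a) v) =
      μ (affineAct B hs hi 0 (loopElt B hs hi (Int.negSucc m) a) (vacuum B hs hi 0)) *
        symbolAt B hs hi ℓ μ k v := by
  rw [symbolAt, symbolAt, LinearMap.smul_apply, LinearMap.comp_apply, LinearMap.smul_apply,
    LinearMap.comp_apply, coact_pow_act B hs hi ℓ hv μ hμ, map_smul, smul_eq_mul, smul_eq_mul,
    smul_eq_mul, Nat.factorial_succ]
  have h1 : ((k : ℂ) + 1) ≠ 0 := Nat.cast_add_one_ne_zero k
  have h2 : (k.factorial : ℂ) ≠ 0 := Nat.cast_ne_zero.2 k.factorial_ne_zero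
  push_cast
  field_simp

end Filtration

/-! ### Polynomial coefficients indexed by integers. -/

section IntCoeff

open Polynomial

/-- The coefficient of `x^k` in a polynomial, for an integer `k`. -/
def intCoeff (g : ℂ[X]) (k : ℤ) : ℂ := if 0 ≤ k then g.coeff k.toNat else 0

theorem intCoeff_sum_mul (c : ℕ → ℂ) (N : ℕ) (g : ℂ[X]) (k : ℤ) :
    intCoeff ((∑ i ∈ Finset.range N, C (c i) * X ^ i) * g) k =
      ∑ i ∈ Finset.range N, c i * intCoeff g (k - i) := by
  rw [Finset.sum_mul]
  simp only [intCoeff, mul_assoc, finsetSum_coeff, coeff_C_mul, coeff_X_pow_mul']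
  split_ifs with h
  · refine Finset.sum_congr rfl fun i _ => ?_
    by_cases hi : i ≤ k.toNat
    · rw [if_pos hi, if_pos (by omega)]
      congr 2
      omega
    · rw [if_neg hi, if_neg (by omega)]
  · refine (Finset.sum_eq_zero fun i _ => ?_).symm
    rw [if_neg (by omega), mul_zero]

end IntCoeff

/-! ### Words and the leading term of their vertex operators. -/

section Words

open Polynomial

variable {𝔤 : Type*} [LieRing 𝔤] [LieAlgebra ℂ 𝔤] (B : LinearMap.BilinForm ℂ 𝔤)
  (hs : B.IsSymm) (hi : B.lieInvariant 𝔤) (ℓ : ℂ)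

/-- The vector `a₁(-m₁-1)⋯aᵣ(-mᵣ-1)𝟏`. -/
def word : List (𝔤 × ℕ) → VacuumModule B hs hi ℓ
  | [] => vacuum B hs hi ℓ
  | c :: l => affineAct B hs hi ℓ (loopElt B hs hi (Int.negSucc c.2) c.1) (word l)

theorem word_cons (a : 𝔤) (m : ℕ) (l : List (𝔤 × ℕ)) : word B hs hi ℓ ((a, m) :: l) =
    affineAct B hs hi ℓ (loopElt B hs hi (Int.negSucc m) a) (word B hs hi ℓ l) := rfl

theorem word_mem_wordFilt (l : List (𝔤 × ℕ)) :
    word B hs hi ℓ l ∈ wordFilt B hs hi ℓ (l.length + 1) := by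
  induction l with
  | nil => exact vacuum_mem_wordFilt B hs hi ℓ 0
  | cons c l ih => exact negSucc_mem_wordFilt B hs hi ℓ ih c.2 c.1

/-- Swapping adjacent letters costs one letter of their bracket, hence a shorter word. There is no
central term, since both exponents are negative. -/
theorem word_sub_word_mem (l l' : List (𝔤 × ℕ)) (h : l.Perm l') :
    word B hs hi ℓ l - word B hs hi ℓ l' ∈ wordFilt B hs hi ℓ l.length := by
  induction h with
  | nil => rw [sub_self]; exact zero_mem _
  | cons c h ih =>
    rw [word_cons, word_cons, ← map_sub]
    exact negSucc_mem_wordFilt B hs hi ℓ ih c.2 c.1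
  | swap c d l =>
    rw [word_cons, word_cons, word_cons, word_cons, affineAct_lie, lie_loopElt,
      if_neg (by omega), zero_smul, add_zero, Int.negSucc_add_negSucc]
    exact negSucc_mem_wordFilt B hs hi ℓ (word_mem_wordFilt B hs hi ℓ l) _ _
  | trans h _ ih ih' =>
    rw [← h.length_eq] at ih'
    simpa using add_mem ih ih'

/-- Each letter enters the iterated products through one mode of its current, which adds at most one
to the length. -/
theorem mode_affineY_word_mem (l : List (𝔤 × ℕ)) (j : ℤ) {k : ℕ} {v}
    (hv : v ∈ wordFilt B hs hi ℓ k) :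
    mode (affineY B hs hi ℓ (word B hs hi ℓ l)) j v ∈ wordFilt B hs hi ℓ (k + l.length) := by
  induction l generalizing j k v with
  | nil =>
    rw [word, affineY_vacuum, ncoeff_idField]
    split_ifs
    · exact hv
    · exact zero_mem _
  | cons c l ih =>
    rw [word_cons, affineY_act, ncoeff_nthProduct]
    obtain ⟨N, hN⟩ := (nthMode_eventually (Int.negSucc c.2) (current B hs hi ℓ c.1)
      (affineY B hs hi ℓ (word B hs hi ℓ l)) j v).exists
    rw [hN]
    refine sub_mem (sum_mem fun i _ => Submodule.smul_mem _ _ ?_)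
      (sum_mem fun i _ => Submodule.smul_mem _ _ ?_)
    · rw [mode_current]
      exact loopElt_mem_wordFilt B hs hi ℓ (ih _ hv) _ _
    · refine wordFilt_le_succ B hs hi ℓ _ (ih _ ?_)
      rw [mode_current]
      exact nonneg_mem_wordFilt B hs hi ℓ hv i _

/-- The polynomial `∑ᵢ (m+i choose i) s(m+i) xⁱ`, for a sequence `s` supported below `J`. -/
def letterPoly (s : ℕ → ℂ) (J m : ℕ) : ℂ[X] :=
  -- This is the `m`-th divided derivative of `∑ⱼ s(j) xʲ`; the range is long enough because `s`
  -- vanishes from `J` on.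
  ∑ i ∈ Finset.range J, C (((m + i).choose i : ℂ) * s (m + i)) * X ^ i

/-- The value of a functional on `V(0)` at `a(-m-1)𝟏`, as a sequence in `m`. -/
def letterValue (μ : Module.Dual ℂ (VacuumModule B hs hi 0)) (a : 𝔤) (m : ℕ) : ℂ :=
  μ (affineAct B hs hi 0 (loopElt B hs hi (Int.negSucc m) a) (vacuum B hs hi 0))

theorem bp_negSucc (m i : ℕ) : bp (Int.negSucc m) i = ((m + i).choose i : ℂ) := by
  have h1 := Ring.choose_neg ((m : ℤ) + 1) i
  rw [show (m : ℤ) + 1 + i - 1 = ((m + i : ℕ) : ℤ) by push_cast; ring, Ring.choose_natCast] at h1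
  rw [bp, Int.negSucc_eq, h1, Units.smul_def, Int.negOnePow_def, smul_eq_mul, zpow_natCast]
  push_cast
  rw [← mul_assoc, ← mul_pow]
  simp

/-- The leading term of `Y(a₁(-m₁-1)⋯aᵣ(-mᵣ-1)𝟏, x)v`. -/
theorem symbolAt_mode_affineY_word (μ : Module.Dual ℂ (VacuumModule B hs hi 0))
    (hμ : μ (vacuum B hs hi 0) = 0) (J : ℕ) (hJ : ∀ a m, J ≤ m → letterValue B hs hi μ a m = 0)
    (l : List (𝔤 × ℕ)) (j : ℤ) {k : ℕ} {v} (hv : v ∈ wordFilt B hs hi ℓ (k + 1)) :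
    symbolAt B hs hi ℓ μ (k + l.length)
        (mode (affineY B hs hi ℓ (word B hs hi ℓ l)) j v) =
      intCoeff (l.map fun c => letterPoly (letterValue B hs hi μ c.1) J c.2).prod (-j - 1) *
        symbolAt B hs hi ℓ μ k v := by
  induction l generalizing j with
  | nil =>
    rw [word, affineY_vacuum, ncoeff_idField, List.map_nil, List.prod_nil, intCoeff, coeff_one]
    by_cases h : j = -1
    · rw [if_pos h, if_pos (by omega), if_pos (by omega), one_mul]
      rfl
    · rw [if_neg h, map_zero]
      split_ifs
      · omega
      · rw [zero_mul]
      · rw [zero_mul]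
  | cons c l ih =>
    obtain ⟨a, m⟩ := c
    obtain ⟨N, hN, hNJ⟩ := ((nthMode_eventually (Int.negSucc m) (current B hs hi ℓ a)
      (affineY B hs hi ℓ (word B hs hi ℓ l)) j v).and (Filter.eventually_ge_atTop J)).exists
    -- In the second half of the product a nonnegative mode of `a` acts first and adds no letter, so
    -- the symbol of top degree kills it. The first half multiplies the symbol by `letterPoly`, its
    -- terms with `i ≥ J` having zero letter value.
    rw [word_cons, affineY_act, ncoeff_nthProduct, hN, map_sub, map_sum, map_sum,
      Finset.sum_eq_zero (s := Finset.range N) (f := fun i => symbolAt B hs hi ℓ μ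
        (k + ((a, m) :: l).length) (bq _ _ • _)), sub_zero]
    · rw [List.map_cons, List.prod_cons, letterPoly, intCoeff_sum_mul, Finset.sum_mul,
        ← Finset.sum_subset (Finset.range_subset_range.2 hNJ)]
      · refine Finset.sum_congr rfl fun i _ => ?_
        rw [map_smul, mode_current, show Int.negSucc m - (i : ℤ) = Int.negSucc (m + i) by omega, List.length_cons, ← add_assoc,
          symbolAt_act B hs hi ℓ μ hμ, ih, bp_negSucc, smul_eq_mul, letterValue]
        · rw [show -j - 1 - i = -(j + i) - 1 by ring]
          ring
        · have := mode_affineY_word_mem B hs hi ℓ l (j + i) hv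
          rwa [add_right_comm] at this
      · intro i _ hi'
        rw [Finset.mem_range, not_lt] at hi'
        rw [map_smul, mode_current, show Int.negSucc m - (i : ℤ) = Int.negSucc (m + i) by omega, List.length_cons, ← add_assoc,
          symbolAt_act B hs hi ℓ μ hμ]
        · have := hJ a (m + i) (by omega)
          rw [letterValue] at this
          rw [this, zero_mul, smul_zero]
        · have := mode_affineY_word_mem B hs hi ℓ l (j + i) hv
          rwa [add_right_comm] at this
    · intro i _
      rw [map_smul, symbolAt_eq_zero B hs hi ℓ μ hμ, smul_zero]
      rw [mode_current, List.length_cons, ← add_assoc, add_right_comm]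
      exact mode_affineY_word_mem B hs hi ℓ l _ (nonneg_mem_wordFilt B hs hi ℓ hv i a)

end Words

/-! ### Functionals applied coefficientwise to iterated Laurent series. -/

section CoeffwiseFunctional

variable {V : Type*} [AddCommGroup V] [Module ℂ V]

/-- A functional on `V`, applied to the coefficients of a series. -/
def coeffwise {n : ℕ} (Θ : Module.Dual ℂ V) : IterLaurentModule n V →ₗ[IterLaurent n] IterLaurent n where
  toFun y := ((HahnModule.of ℂ).symm y).map Θ
  map_add' y z := by
    ext k
    exact map_add Θ _ _
  map_smul' f y := by
    have h : (RingHom.id (IterLaurent n)) f • ((HahnModule.of ℂ).symm y).map Θ =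
      (HahnModule.of ℂ).symm (f • HahnModule.of ℂ (((HahnModule.of ℂ).symm y).map Θ)) := rfl
    rw [h]
    ext k
    -- Applying `Θ` may shrink the support, so the product on the right is summed over the support
    -- of `y`; then the two sums match term by term.
    rw [HahnModule.coeff_smul_right (x := f)
      (y := HahnModule.of ℂ (((HahnModule.of ℂ).symm y).map Θ)) (a := k)
      ((HahnModule.of ℂ).symm y).isPWO_support (Function.support_comp_subset (map_zero Θ) _)]
    change Θ (((HahnModule.of ℂ).symm (f • y)).coeff k) = _
    rw [HahnModule.coeff_smul, map_sum]
    refine Finset.sum_congr rfl fun x _ => ?_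
    rw [map_smul]
    rfl

theorem coeffwise_coeff {n : ℕ} (Θ : Module.Dual ℂ V) (y : IterLaurentModule n V) (k : Expo n) :
    (coeffwise Θ y).coeff k = Θ (((HahnModule.of ℂ).symm y).coeff k) := rfl

theorem coeff_iterY (Y : V →ₗ[ℂ] VertexOperator ℂ V) (w : V) (n : ℕ) (u : Fin n → V)
    (k : Expo n) :
    ((HahnModule.of ℂ).symm (iterY Y w n u)).coeff k = prodCoeff Y n u k.toFun w := rfl

theorem prodCoeff_succ (Y : V →ₗ[ℂ] VertexOperator ℂ V) (n : ℕ) (u : Fin (n + 1) → V)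
    (k : Fin (n + 1) → ℤ) (w : V) :
    prodCoeff Y (n + 1) u k w = mode (Y (u 0)) (-k 0 - 1)
      (prodCoeff Y n (fun i => u i.succ) (fun i => k i.succ) w) := by
  rw [prodCoeff, List.ofFn_succ, List.prod_cons, Module.End.mul_apply,
    VertexOperator.coeff_eq_ncoeff]
  rfl

end CoeffwiseFunctional

/-! ### The series `xᵢ` and products of polynomials in separate variables. -/

section Variables

open Polynomial

/-- The series `xᵢ`. -/
def iterVar {n : ℕ} (i : Fin n) : IterLaurent n :=
  HahnSeries.single (Expo.mk (Pi.single i 1)) 1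

theorem iterVar_injective (n : ℕ) : Function.Injective (iterVar (n := n)) := by
  intro i j h
  by_contra hij
  have h1 := congrArg (fun f => HahnSeries.coeff f (Expo.mk (Pi.single i 1))) h
  simp only [iterVar, HahnSeries.coeff_single_same] at h1
  rw [HahnSeries.coeff_single_of_ne] at h1
  · exact one_ne_zero h1
  · intro h2
    have h3 : (Pi.single i 1 : Fin n → ℤ) i = (Pi.single j 1 : Fin n → ℤ) i := congrFun h2 i
    rw [Pi.single_eq_same, Pi.single_eq_of_ne hij] at h3
    exact one_ne_zero h3

theorem prod_iterVar_pow {n : ℕ} (c : Fin n → ℂ) (x : Fin n → ℕ) :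
    ∏ i, (c i • iterVar i ^ x i) =
      HahnSeries.single (Expo.mk fun i => (x i : ℤ)) (∏ i, c i) := by
  have h : ∀ s : Finset (Fin n), ∏ i ∈ s, (c i • iterVar i ^ x i) =
      HahnSeries.single (∑ i ∈ s, x i • Expo.mk (Pi.single i 1)) (∏ i ∈ s, c i) := by
    classical
    intro s
    induction s using Finset.induction_on with
    | empty => rfl
    | insert i s hi' ih =>
      rw [Finset.prod_insert hi', Finset.prod_insert hi', Finset.sum_insert hi', ih, iterVar,
        HahnSeries.single_pow, one_pow, ← HahnSeries.single_zero_mul_eq_smul,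
        HahnSeries.single_mul_single, HahnSeries.single_mul_single, zero_add, mul_one]
  rw [h]
  refine congrArg (fun k => HahnSeries.single k _) ?_
  have e : ∀ i : Fin n, x i • Expo.mk (Pi.single i 1) = Expo.mk (Pi.single i (x i : ℤ)) := by
    intro i
    change (x i • (Pi.single i 1 : Fin n → ℤ)) = Pi.single i (x i : ℤ)
    rw [← Pi.single_smul]
    simp
  rw [Finset.sum_congr rfl fun i _ => e i]
  exact Finset.univ_sum_single (fun i => (x i : ℤ))

/-- The variables are separate, so expanding the product reaches the exponent `k` through at most
one choice of terms. -/
theorem coeff_prod_aeval {n : ℕ} (g : Fin n → ℂ[X]) (k : Expo n) :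
    (∏ i, aeval (iterVar i) (g i)).coeff k = ∏ i, intCoeff (g i) (k.toFun i) := by
  obtain ⟨N, hN⟩ : ∃ N, ∀ i, (g i).natDegree < N :=
    ⟨(Finset.univ.sup fun i => (g i).natDegree) + 1, fun i =>
      Nat.lt_succ_of_le (Finset.le_sup (f := fun i => (g i).natDegree) (Finset.mem_univ i))⟩
  rw [Finset.prod_congr rfl fun i _ => aeval_eq_sum_range' (hN i) (iterVar i),
    Finset.prod_univ_sum, HahnSeries.coeff_sum]
  simp only [prod_iterVar_pow]
  by_cases hk : ∀ i, 0 ≤ k.toFun i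
  · have hk' : k = Expo.mk fun i => (((k.toFun i).toNat : ℕ) : ℤ) :=
      funext fun i => (Int.toNat_of_nonneg (hk i)).symm
    rw [Finset.sum_eq_single fun i => (k.toFun i).toNat]
    · rw [← hk', HahnSeries.coeff_single_same]
      refine Finset.prod_congr rfl fun i _ => ?_
      rw [intCoeff, if_pos (hk i)]
    · intro x _ hx
      rw [HahnSeries.coeff_single_of_ne]
      rintro rfl
      exact hx (funext fun i => (Int.toNat_natCast (x i)).symm)
    · intro hx
      rw [← hk', HahnSeries.coeff_single_same]
      rw [Fintype.mem_piFinset] at hx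
      push Not at hx
      obtain ⟨i, hi'⟩ := hx
      refine Finset.prod_eq_zero (Finset.mem_univ i) (coeff_eq_zero_of_natDegree_lt ?_)
      rw [Finset.mem_range, not_lt] at hi'
      exact (hN i).trans_le hi'
  · push Not at hk
    obtain ⟨i, hi'⟩ := hk
    rw [Finset.prod_eq_zero (Finset.mem_univ i) (by rw [intCoeff, if_neg (by omega)])]
    refine Finset.sum_eq_zero fun x _ => ?_
    rw [HahnSeries.coeff_single_of_ne]
    rintro rfl
    exact absurd (Int.natCast_nonneg (x i)) (not_le.2 hi')

end Variables

/-! ### Leading terms of `Y(u₁, x₁)⋯Y(uₙ, xₙ)𝟏`. -/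

section LeadingTerm

open Polynomial

variable {𝔤 : Type*} [LieRing 𝔤] [LieAlgebra ℂ 𝔤] (B : LinearMap.BilinForm ℂ 𝔤)
  (hs : B.IsSymm) (hi : B.lieInvariant 𝔤) (ℓ : ℂ)

theorem prodCoeff_word_mem {n : ℕ} (l : Fin n → List (𝔤 × ℕ)) (k : Fin n → ℤ) :
    prodCoeff (affineY B hs hi ℓ) n (fun i => word B hs hi ℓ (l i)) k (vacuum B hs hi ℓ) ∈
      wordFilt B hs hi ℓ (∑ i, (l i).length + 1) := by
  induction n with
  | zero => exact vacuum_mem_wordFilt B hs hi ℓ _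
  | succ n ih =>
    rw [prodCoeff_succ, Fin.sum_univ_succ, add_assoc, add_comm]
    exact mode_affineY_word_mem B hs hi ℓ _ _ (ih _ _)

/-- The leading coefficients of `Y(u₁, x₁)⋯Y(uₙ, xₙ)𝟏` for words `u₁, …, uₙ`. -/
theorem symbolAt_prodCoeff_word (μ : Module.Dual ℂ (VacuumModule B hs hi 0))
    (hμ : μ (vacuum B hs hi 0) = 0) (J : ℕ) (hJ : ∀ a m, J ≤ m → letterValue B hs hi μ a m = 0)
    {n : ℕ} (l : Fin n → List (𝔤 × ℕ)) (k : Fin n → ℤ) :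
    symbolAt B hs hi ℓ μ (∑ i, (l i).length) (prodCoeff (affineY B hs hi ℓ) n
        (fun i => word B hs hi ℓ (l i)) k (vacuum B hs hi ℓ)) =
      ∏ i, intCoeff ((l i).map fun c => letterPoly (letterValue B hs hi μ c.1) J c.2).prod
        (k i) := by
  induction n with
  | zero => exact symbolAt_vacuum B hs hi ℓ μ
  | succ n ih =>
    rw [prodCoeff_succ, Fin.sum_univ_succ, add_comm, Fin.prod_univ_succ,
      symbolAt_mode_affineY_word B hs hi ℓ μ hμ J hJ _ _ (prodCoeff_word_mem B hs hi ℓ _ _), ih,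
      show -(-k 0 - 1) - 1 = k 0 by ring]

/-- This carries a `V`-valued series to an element of the field `ℂ((x₁))⋯((xₙ))`. Each letter of
`uᵢ` has become a divided derivative evaluated at `xᵢ`. -/
theorem coeffwise_symbolAt_iterY_word (μ : Module.Dual ℂ (VacuumModule B hs hi 0))
    (hμ : μ (vacuum B hs hi 0) = 0) (J : ℕ) (hJ : ∀ a m, J ≤ m → letterValue B hs hi μ a m = 0)
    {n : ℕ} (l : Fin n → List (𝔤 × ℕ)) :
    coeffwise (symbolAt B hs hi ℓ μ (∑ i, (l i).length))
        (iterY (affineY B hs hi ℓ) (vacuum B hs hi ℓ) n fun i => word B hs hi ℓ (l i)) =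
      ∏ i, ((l i).map fun c =>
        aeval (iterVar i) (letterPoly (letterValue B hs hi μ c.1) J c.2)).prod := by
  have h : ∀ i, ((l i).map fun c =>
        aeval (iterVar i) (letterPoly (letterValue B hs hi μ c.1) J c.2)).prod =
      aeval (iterVar i)
        ((l i).map fun c => letterPoly (letterValue B hs hi μ c.1) J c.2).prod := by
    intro i
    rw [map_list_prod, List.map_map]
    rfl
  rw [Finset.prod_congr rfl fun i _ => h i]
  ext k
  rw [coeffwise_coeff, coeff_iterY, symbolAt_prodCoeff_word B hs hi ℓ μ hμ J hJ,
    coeff_prod_aeval]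

/-- Words of total length below `d` are invisible to the symbol of degree `d`, so a relation can be
tested on its longest terms alone. -/
theorem coeffwise_symbolAt_iterY_word_of_lt (μ : Module.Dual ℂ (VacuumModule B hs hi 0))
    (hμ : μ (vacuum B hs hi 0) = 0) {n d : ℕ} (l : Fin n → List (𝔤 × ℕ))
    (hd : ∑ i, (l i).length < d) :
    coeffwise (symbolAt B hs hi ℓ μ d)
        (iterY (affineY B hs hi ℓ) (vacuum B hs hi ℓ) n fun i => word B hs hi ℓ (l i)) = 0 := by
  ext k
  rw [coeffwise_coeff, coeff_iterY]
  exact symbolAt_eq_zero B hs hi ℓ μ hμ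
    (wordFilt_mono B hs hi ℓ hd (prodCoeff_word_mem B hs hi ℓ _ _))

end LeadingTerm

/-! ### Hermite interpolation over a field. -/

section Confluent

open Polynomial

variable {K : Type*} [Field K]

/-- A linear form in the jets of order less than `M` at the points `xᵢ` vanishes if it vanishes on
the polynomials `(X - xᵢ)^m ∏_{j ≠ i} (X - xⱼ)^M`, `m < M`. -/
theorem eq_zero_of_sum_jet_eq_zero {n M : ℕ} (x : Fin n → K) (hx : Function.Injective x)
    (c : Fin n × Fin M → K)
    (h : ∀ p : Fin n × Fin M,
      ∑ q, c q * (taylor (x q.1) ((X - C (x p.1)) ^ (p.2 : ℕ) *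
        ∏ i ∈ Finset.univ.erase p.1, (X - C (x i)) ^ M)).coeff q.2 = 0) : c = 0 := by
  classical
  by_contra hc
  obtain ⟨q₀, hq₀⟩ := Function.ne_iff.1 hc
  -- Take the highest order `m` with nonzero coefficient at one point. The test polynomial of index
  -- `m` there has zero jets at the other points and zero jets below `m` at this one, while higher
  -- coefficients vanish by maximality; one nonzero term is left.
  obtain ⟨m, hm, hmax⟩ := (Finset.univ.filter fun m : Fin M => c (q₀.1, m) ≠ 0).exists_maximal
    ⟨q₀.2, by simpa using hq₀⟩
  have hm' : c (q₀.1, m) ≠ 0 := by simpa using hm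
  have hgt : ∀ m', m < m' → c (q₀.1, m') = 0 := fun m' hlt => by
    by_contra hne
    exact absurd (hmax (by simpa using hne) hlt.le) (not_le.2 hlt)
  have hX : ∀ (a b : K), taylor a (X - C b) = X + C (a - b) := fun a b => by
    rw [map_sub, taylor_X, taylor_C, C_sub]
    ring
  have h1 := h (q₀.1, m)
  rw [Finset.sum_eq_single (q₀.1, m)] at h1
  · rw [taylor_mul, taylor_pow, hX, sub_self, C_0, add_zero, coeff_X_pow_mul', if_pos le_rfl,
      Nat.sub_self, taylor_coeff_zero, eval_prod] at h1
    refine (mul_ne_zero hm' (Finset.prod_ne_zero_iff.2 fun i hi => ?_)) h1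
    rw [eval_pow, eval_sub, eval_X, eval_C]
    exact pow_ne_zero _ (sub_ne_zero.2 fun e => (Finset.mem_erase.1 hi).1 (hx e.symm))
  · rintro ⟨i, m'⟩ _ hne
    by_cases hi : i = q₀.1
    · subst hi
      rcases lt_trichotomy m' m with hlt | heq | hlt
      · rw [taylor_mul, taylor_pow, hX, sub_self, C_0, add_zero, coeff_X_pow_mul',
          if_neg (show ¬ ((m : ℕ) ≤ m') from not_le.2 hlt), mul_zero]
      · exact absurd (by rw [heq]) hne
      · rw [hgt _ hlt, zero_mul]
    · rw [← Finset.mul_prod_erase _ _ (Finset.mem_erase.2 ⟨hi, Finset.mem_univ i⟩),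
        mul_left_comm, taylor_mul, taylor_pow, hX, sub_self, C_0, add_zero, coeff_X_pow_mul',
        if_neg (not_le.2 m'.2), mul_zero]
  · exact fun h => absurd (Finset.mem_univ _) h

theorem taylor_coeff_eq_sum (r : K) (p : K[X]) (J m : ℕ) (hp : p.natDegree < J) :
    (taylor r p).coeff m =
      ∑ j ∈ Finset.range J, p.coeff j * (r ^ (j - m) * (j.choose m : K)) := by
  conv_lhs => rw [p.as_sum_range' J hp]
  rw [map_sum, finsetSum_coeff]
  refine Finset.sum_congr rfl fun j _ => ?_
  rw [taylor_monomial, coeff_C_mul, coeff_X_add_C_pow]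

/-- The confluent Vandermonde system is solvable. -/
theorem exists_confluent_solution {n : ℕ} (M : ℕ) (x : Fin n → K) (hx : Function.Injective x) :
    ∃ J, ∀ g : Fin n → ℕ → K, ∃ s : ℕ → K, ∀ i, ∀ m < M,
      ∑ j ∈ Finset.range J, s j * (x i ^ (j - m) * (j.choose m : K)) = g i m := by
  classical
  let P : Fin n × Fin M → K[X] := fun p => (X - C (x p.1)) ^ (p.2 : ℕ) *
        ∏ i ∈ Finset.univ.erase p.1, (X - C (x i)) ^ M
  obtain ⟨J, hJ⟩ : ∃ J, ∀ p, (P p).natDegree < J :=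
    ⟨(Finset.univ.sup fun p => (P p).natDegree) + 1, fun p =>
      Nat.lt_succ_of_le (Finset.le_sup (f := fun p => (P p).natDegree) (Finset.mem_univ p))⟩
  refine ⟨J, ?_⟩
  -- `T` sends the coefficients of a polynomial of degree below `J` to its jets of order below `M`
  -- at the points `x i`.
  let T : (ℕ → K) →ₗ[K] (Fin n × Fin M → K) := LinearMap.pi fun q =>
    ∑ j ∈ Finset.range J, (x q.1 ^ (j - q.2) * (j.choose q.2 : K)) • LinearMap.proj j
  have hT : ∀ s q, T s q =
      ∑ j ∈ Finset.range J, s j * (x q.1 ^ (j - q.2) * (j.choose q.2 : K)) := by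
    intro s q
    simp [T, mul_comm]
  have hsurj : LinearMap.range T = ⊤ := by
    by_contra hne
    obtain ⟨f, hf, hf'⟩ := Submodule.exists_dual_map_eq_bot_of_lt_top
      (lt_top_iff_ne_top.2 hne) inferInstance
    apply hf
    have h1 : ∀ b, f (T b) = 0 := fun b => by
      have : f (T b) ∈ (LinearMap.range T).map f := ⟨_, ⟨b, rfl⟩, rfl⟩
      rw [hf'] at this
      exact (Submodule.mem_bot K).1 this
    have h2 : ∀ w, f w = ∑ a, f (Pi.single a 1) * w a := fun w => by
      conv_lhs => rw [← Finset.univ_sum_single w, map_sum]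
      refine Finset.sum_congr rfl fun a _ => ?_
      rw [mul_comm, ← smul_eq_mul, ← map_smul, ← Pi.single_smul, smul_eq_mul, mul_one]
    -- A linear form vanishing on the range of `T` kills the jets of every `P p`, because `J`
    -- exceeds their degrees.
    have h3 := eq_zero_of_sum_jet_eq_zero x hx (fun a => f (Pi.single a 1)) fun p => by
      have h4 := h1 (P p).coeff
      rw [h2] at h4
      rw [← h4]
      refine Finset.sum_congr rfl fun q _ => ?_
      rw [hT, taylor_coeff_eq_sum _ _ J _ (hJ p)]
    refine LinearMap.ext fun w => ?_
    rw [h2, LinearMap.zero_apply]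
    exact Finset.sum_eq_zero fun a _ => by rw [congrFun h3 a, Pi.zero_apply, zero_mul]
  intro g
  obtain ⟨s, hs⟩ := LinearMap.range_eq_top.1 hsurj fun q => g q.1 q.2
  exact ⟨s, fun i m hm => by rw [← congrFun hs (i, ⟨m, hm⟩), hT]⟩

/-- The divided derivative `∑ⱼ (j choose m) s(j) x^(j-m)`, reindexed by the exponent of `x`. -/
theorem sum_jet_reindex (x : K) (s : ℕ → K) (J m : ℕ) :
    ∑ i ∈ Finset.range J, ((m + i).choose i : K) * (if m + i < J then s (m + i) else 0) * x ^ i =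
      ∑ j ∈ Finset.range J, s j * (x ^ (j - m) * (j.choose m : K)) := by
  let f : ℕ → K := fun j => (if j < J then s j else 0) * (x ^ (j - m) * (j.choose m : K))
  have h1 : ∑ j ∈ Finset.range J, s j * (x ^ (j - m) * (j.choose m : K)) =
      ∑ j ∈ Finset.range (m + J), f j := by
    rw [← Finset.sum_subset (Finset.range_subset_range.2 (Nat.le_add_left J m))]
    · refine Finset.sum_congr rfl fun j hj => ?_
      simp only [f]
      rw [if_pos (Finset.mem_range.1 hj)]
    · intro j _ hj
      simp only [f]
      rw [if_neg (by simpa using hj), zero_mul]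
  rw [h1, Finset.sum_range_add, Finset.sum_eq_zero (s := Finset.range m), zero_add]
  · refine Finset.sum_congr rfl fun i _ => ?_
    simp only [f]
    rw [Nat.add_sub_cancel_left, Nat.choose_symm_add]
    ring
  · intro j hj
    simp only [f]
    rw [Nat.choose_eq_zero_of_lt (Finset.mem_range.1 hj), Nat.cast_zero, mul_zero, mul_zero]

end Confluent

/-! ### Polynomials vanishing on jets of complex sequences. -/

section Vanishing

variable {K : Type*} [Field K] [Algebra ℂ K]

/-- A polynomial vanishing at the jets of all complex sequences is zero. -/
theorem mvPolynomial_eq_zero_of_jets {n : ℕ} {I : Type*} (x : Fin n → K)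
    (hx : Function.Injective x) (P : MvPolynomial (Fin n × I × ℕ) K)
    (h : ∀ (s : I → ℕ → ℂ) (J : ℕ), MvPolynomial.eval (fun v : Fin n × I × ℕ =>
      ∑ i ∈ Finset.range J, ((v.2.2 + i).choose i : K) *
        (if v.2.2 + i < J then algebraMap ℂ K (s v.2.1 (v.2.2 + i)) else 0) * x v.1 ^ i) P = 0) :
    P = 0 := by
  have hinf : Infinite K := Infinite.of_injective _ (algebraMap ℂ K).injective
  refine MvPolynomial.funext fun g => ?_
  rw [map_zero]
  -- The jets needed are those occurring in the variables of `P`. The bound `J` does not depend on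
  -- the target values, so a single one serves all of `I`.
  obtain ⟨J, hJ⟩ := exists_confluent_solution (P.vars.sup (fun v => v.2.2) + 1) x hx
  choose s hs using fun a : I => hJ fun i m => g (i, a, m)
  -- `G` is the jet of the generic sequence, whose entries are indeterminates.
  let G : Fin n × I × ℕ → MvPolynomial (I × ℕ) K := fun v =>
    ∑ i ∈ Finset.range J, MvPolynomial.C ((v.2.2 + i).choose i : K) *
        (if v.2.2 + i < J then MvPolynomial.X (v.2.1, v.2.2 + i) else 0) *
          MvPolynomial.C (x v.1) ^ i
  have hG : ∀ (t : I × ℕ → K), MvPolynomial.eval t (MvPolynomial.bind₁ G P) =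
      MvPolynomial.eval (fun v : Fin n × I × ℕ =>
      ∑ i ∈ Finset.range J, ((v.2.2 + i).choose i : K) *
        (if v.2.2 + i < J then t (v.2.1, v.2.2 + i) else 0) * x v.1 ^ i) P := by
    intro t
    rw [MvPolynomial.eval, MvPolynomial.eval₂Hom_bind₁]
    congr 2
    ext v
    simp only [G, map_sum, map_mul, map_pow, MvPolynomial.eval₂Hom_C, RingHom.id_apply]
    refine Finset.sum_congr rfl fun i _ => ?_
    split_ifs
    · rw [MvPolynomial.eval₂Hom_X']
    · rw [map_zero]
  -- By hypothesis the substituted polynomial vanishes whenever its indeterminates take complex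
  -- values, and `ℂ` has infinite image in `K`.
  have hQ : MvPolynomial.bind₁ G P = 0 := by
    refine MvPolynomial.funext_set (fun _ => Set.range (algebraMap ℂ K))
      (fun _ => Set.infinite_range_of_injective (algebraMap ℂ K).injective) fun t ht => ?_
    choose s hs using fun v => ht v (Set.mem_univ v)
    rw [map_zero, hG]
    refine Eq.trans ?_ (h (fun a m => s (a, m)) J)
    simp only [hs]
  -- Specializing the generic sequence to the interpolating one makes the jets equal to `g` on the
  -- variables of `P`.
  have h1 := hG fun v => s v.1 v.2
  rw [hQ, map_zero] at h1
  rw [h1]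
  refine MvPolynomial.hom_congr_vars ?_ ?_ rfl
  · ext; simp
  · intro v hv _
    rw [MvPolynomial.eval_X, MvPolynomial.eval_X,
      sum_jet_reindex (x v.1) (s v.2.1), hs v.2.1 v.1 v.2.2]
    exact Nat.lt_succ_of_le (Finset.le_sup (f := fun v : Fin n × I × ℕ => v.2.2) hv)

end Vanishing

/-! ### Spanning by unordered words in basis letters. -/

section Spanning

theorem multilinearMap_mem_span {n : ℕ} {V W ι : Type*} [AddCommGroup V] [Module ℂ V]
    [AddCommGroup W] [Module ℂ W] (f : MultilinearMap ℂ (fun _ : Fin n => V) W) (v : ι → V)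
    (u : Fin n → V) (hu : ∀ i, u i ∈ Submodule.span ℂ (Set.range v)) :
    f u ∈ Submodule.span ℂ (Set.range fun S : Fin n → ι => f fun i => v (S i)) := by
  choose c hc using fun i => Finsupp.mem_span_range_iff_exists_finsupp.1 (hu i)
  have e : u = fun i => ∑ j ∈ (c i).support, c i j • v j := funext fun i => (hc i).symm
  rw [e, MultilinearMap.map_sum_finset]
  refine sum_mem fun r _ => ?_
  rw [MultilinearMap.map_smul_univ]
  exact Submodule.smul_mem _ _ (Submodule.subset_span ⟨r, rfl⟩)

theorem exists_sum_tprod_tmul {n : ℕ} {V W ι : Type*} [AddCommGroup V] [Module ℂ V]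
    [AddCommGroup W] [Module ℂ W] (v : ι → V) (hv : Submodule.span ℂ (Set.range v) = ⊤)
    (t : (PiTensorProduct ℂ fun _ : Fin n => V) ⊗[ℂ] W) :
    ∃ f : (Fin n → ι) →₀ W,
      t = f.sum fun S w => PiTensorProduct.tprod ℂ (fun i => v (S i)) ⊗ₜ[ℂ] w := by
  let Q : ((Fin n → ι) →₀ W) →ₗ[ℂ] (PiTensorProduct ℂ fun _ : Fin n => V) ⊗[ℂ] W :=
    Finsupp.lsum ℂ fun S => TensorProduct.mk ℂ _ _ (PiTensorProduct.tprod ℂ (fun i => v (S i)))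
  suffices h : t ∈ LinearMap.range Q by
    obtain ⟨f, hf⟩ := h
    exact ⟨f, hf.symm⟩
  induction t using TensorProduct.induction_on with
  | zero => exact zero_mem _
  | add s t hs ht => exact add_mem hs ht
  | tmul x w =>
    have hx : x ∈ Submodule.span ℂ (Set.range fun S : Fin n → ι =>
        PiTensorProduct.tprod ℂ fun i => v (S i)) := by
      have hx : x ∈ Submodule.span ℂ (Set.range (PiTensorProduct.tprod ℂ (s := fun _ => V))) := by
        rw [PiTensorProduct.span_tprod_eq_top]
        trivial
      refine Submodule.span_le.2 ?_ hx
      rintro _ ⟨u, rfl⟩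
      exact multilinearMap_mem_span _ v u fun i => by rw [hv]; trivial
    induction hx using Submodule.span_induction with
    | mem x hx =>
      obtain ⟨S, rfl⟩ := hx
      exact ⟨Finsupp.single S w, by simp [Q]⟩
    | zero => rw [TensorProduct.zero_tmul]; exact zero_mem _
    | add x y _ _ hx hy => rw [TensorProduct.add_tmul]; exact add_mem hx hy
    | smul r x _ hx => rw [← TensorProduct.smul_tmul']; exact Submodule.smul_mem _ r hx

variable {𝔤 : Type*} [LieRing 𝔤] [LieAlgebra ℂ 𝔤] (B : LinearMap.BilinForm ℂ 𝔤)
  (hs : B.IsSymm) (hi : B.lieInvariant 𝔤) (ℓ : ℂ) {I : Type*} (e : Module.Basis I ℂ 𝔤)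

/-- The letters of a multiset of basis letters, in some order. -/
def letters (s : Multiset (I × ℕ)) : List (𝔤 × ℕ) := s.toList.map fun c => (e c.1, c.2)

theorem length_letters (s : Multiset (I × ℕ)) : (letters e s).length = s.card := by
  rw [letters, List.length_map, Multiset.length_toList]

theorem prod_map_letters {R : Type*} [CommMonoid R] (s : Multiset (I × ℕ)) (F : 𝔤 × ℕ → R) :
    ((letters e s).map F).prod = (s.map fun c => F (e c.1, c.2)).prod := by
  rw [letters, List.map_map, ← Multiset.prod_coe, ← Multiset.map_coe, Multiset.coe_toList]
  rfl

theorem letters_cons_perm (a : I) (m : ℕ) (s : Multiset (I × ℕ)) :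
    ((e a, m) :: letters e s).Perm (letters e ((a, m) ::ₘ s)) := by
  rw [← Multiset.coe_eq_coe, ← Multiset.cons_coe, letters, letters, ← Multiset.map_coe,
    ← Multiset.map_coe, Multiset.coe_toList, Multiset.coe_toList, Multiset.map_cons]

/-- This is the easy half of Poincaré–Birkhoff–Witt: letters expand in the basis, and reordering
them costs shorter words, already covered by the induction hypothesis. -/
theorem wordFilt_le_span (k : ℕ) : wordFilt B hs hi ℓ k ≤
    Submodule.span ℂ ((fun s => word B hs hi ℓ (letters e s)) '' {s | s.card < k}) := by
  induction k with
  | zero => rw [wordFilt]; exact bot_le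
  | succ k ih =>
    have hmono : Submodule.span ℂ
          ((fun s => word B hs hi ℓ (letters e s)) '' {s | s.card < k}) ≤
        Submodule.span ℂ
          ((fun s => word B hs hi ℓ (letters e s)) '' {s | s.card < k + 1}) :=
      Submodule.span_mono (Set.image_mono fun s hs => Nat.lt_succ_of_lt hs)
    rw [wordFilt, Submodule.span_le, Set.union_subset_iff]
    constructor
    · rintro _ rfl
      refine Submodule.subset_span ⟨0, Nat.succ_pos k, ?_⟩
      simp [letters, word]
    · rintro _ ⟨m, a, v, hv, rfl⟩
      have ha : a ∈ Submodule.span ℂ (Set.range e) := by rw [e.span_eq]; trivial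
      have hv' := ih hv
      clear hv
      induction hv' using Submodule.span_induction with
      | zero => rw [map_zero]; exact zero_mem _
      | add x y _ _ hx hy => rw [map_add]; exact add_mem hx hy
      | smul r x _ hx => rw [map_smul]; exact Submodule.smul_mem _ r hx
      | mem x hx =>
        obtain ⟨s, hs', rfl⟩ := hx
        induction ha using Submodule.span_induction with
        | zero => rw [map_zero, map_zero, LinearMap.zero_apply]; exact zero_mem _
        | add x y _ _ hx hy =>
          rw [map_add, map_add, LinearMap.add_apply]
          exact add_mem hx hy
        | smul r x _ hx =>
          rw [map_smul, map_smul, LinearMap.smul_apply]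
          exact Submodule.smul_mem _ r hx
        | mem x hx =>
          obtain ⟨a, rfl⟩ := hx
          have h := word_sub_word_mem B hs hi ℓ _ _ (letters_cons_perm e a m s)
          rw [List.length_cons, length_letters] at h
          have h' := hmono (ih (wordFilt_mono B hs hi ℓ hs' h))
          rw [← word_cons]
          rw [← sub_add_cancel (word B hs hi ℓ ((e a, m) :: letters e s))
            (word B hs hi ℓ (letters e ((a, m) ::ₘ s)))]
          refine add_mem h' (Submodule.subset_span ⟨_, ?_, rfl⟩)
          change Multiset.card ((a, m) ::ₘ s) < k + 1
          rw [Multiset.card_cons]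
          exact Nat.succ_lt_succ hs'

theorem span_word_letters :
    Submodule.span ℂ (Set.range fun s => word B hs hi ℓ (letters e s)) = ⊤ := by
  rw [eq_top_iff]
  intro v _
  obtain ⟨k, hk⟩ := exists_mem_wordFilt B hs hi ℓ v
  exact Submodule.span_mono (Set.image_subset_range _ _) (wordFilt_le_span B hs hi ℓ e k hk)

end Spanning

/-! ### Families of multisets as exponents of monomials. -/

section Exponents

variable {ι : Type*} {n : ℕ}

/-- The exponent of the monomial in the variables `Fin n × ι` given by a family of multisets. -/
def multiExpo (S : Fin n → Multiset ι) : Fin n × ι →₀ ℕ :=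
  open Classical in ∑ i, Multiset.toFinsupp ((S i).map (Prod.mk i))

/-- The exponent of the variable `(i, c)` is the multiplicity of `c` in `S i`. -/
theorem multiExpo_injective : Function.Injective (multiExpo (ι := ι) (n := n)) := by
  classical
  have key : ∀ (S : Fin n → Multiset ι) i c, multiExpo S (i, c) = (S i).count c := by
    intro S i c
    rw [multiExpo, Finsupp.finsetSum_apply, Finset.sum_eq_single i]
    · rw [← Multiset.count_map_eq_count' (Prod.mk i) (S i) (Prod.mk_right_injective i)]
      simp [Multiset.toFinsupp_apply]
    · intro j _ hj
      rw [Multiset.toFinsupp_apply, Multiset.count_eq_zero]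
      intro h
      obtain ⟨c', _, hc'⟩ := Multiset.mem_map.1 h
      exact hj (congrArg Prod.fst hc')
    · exact fun h => absurd (Finset.mem_univ i) h
  intro S T h
  funext i
  ext c
  rw [← key, ← key, h]

theorem prod_X_eq_monomial {σ K : Type*} [CommSemiring K] [DecidableEq σ] (s : Multiset σ) :
    (s.map (MvPolynomial.X (R := K))).prod = MvPolynomial.monomial (Multiset.toFinsupp s) 1 := by
  induction s using Multiset.induction_on with
  | empty => simp
  | cons a s ih =>
    rw [Multiset.map_cons, Multiset.prod_cons, ih, ← Multiset.singleton_add, map_add,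
      Multiset.toFinsupp_singleton, MvPolynomial.X, MvPolynomial.monomial_mul, mul_one]

theorem eval_monomial_multiExpo {K : Type*} [CommSemiring K] (S : Fin n → Multiset ι) (c : K)
    (g : Fin n × ι → K) : MvPolynomial.eval g (MvPolynomial.monomial (multiExpo S) c) =
      c * ∏ i, ((S i).map fun a => g (i, a)).prod := by
  classical
  have h : MvPolynomial.monomial (multiExpo S) c = MvPolynomial.C c *
      ∏ i, (((S i).map (Prod.mk i)).map (MvPolynomial.X (R := K))).prod := by
    simp only [prod_X_eq_monomial]
    rw [← MvPolynomial.monomial_sum_one, MvPolynomial.C_mul_monomial, mul_one, multiExpo]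
  rw [h, map_mul, MvPolynomial.eval_C, map_prod]
  congr 1
  refine Finset.prod_congr rfl fun i _ => ?_
  rw [map_multiset_prod, Multiset.map_map, Multiset.map_map]
  simp

theorem coeff_sum_monomial_multiExpo {K : Type*} [CommSemiring K]
    (T : Finset (Fin n → Multiset ι)) (f : (Fin n → Multiset ι) → K) (S₀ : Fin n → Multiset ι)
    (hS₀ : S₀ ∈ T) : MvPolynomial.coeff (multiExpo S₀)
      (∑ S ∈ T, MvPolynomial.monomial (multiExpo S) (f S)) = f S₀ := by
  classical
  rw [MvPolynomial.coeff_sum, Finset.sum_eq_single S₀]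
  · rw [MvPolynomial.coeff_monomial, if_pos rfl]
  · intro S _ hS
    rw [MvPolynomial.coeff_monomial, if_neg fun h => hS (multiExpo_injective h)]
  · exact fun h => absurd hS₀ h

end Exponents

/-! ### Linear independence of the monomial series, and nondegeneracy. -/

section Independence

variable {𝔤 : Type*} [LieRing 𝔤] [LieAlgebra ℂ 𝔤] (B : LinearMap.BilinForm ℂ 𝔤)
  (hs : B.IsSymm) (hi : B.lieInvariant 𝔤) (ℓ : ℂ) {I : Type*} (e : Module.Basis I ℂ 𝔤)

/-- The series `Y(u₁, x₁)⋯Y(uₙ, xₙ)𝟏`, for `u₁, …, uₙ` monomials in basis letters. -/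
def monomialSeries {n : ℕ} (S : Fin n → Multiset (I × ℕ)) :
    IterLaurentModule n (VacuumModule B hs hi ℓ) :=
  iterY (affineY B hs hi ℓ) (vacuum B hs hi ℓ) n fun i => word B hs hi ℓ (letters e (S i))

/-- This brings the leading term to the shape of the jets in `mvPolynomial_eq_zero_of_jets`. -/
theorem aeval_letterPoly {n : ℕ} (s : ℕ → ℂ) (J m : ℕ) (i : Fin n)
    (hs : ∀ j, J ≤ j → s j = 0) :
    Polynomial.aeval (iterVar i) (letterPoly s J m) =
      ∑ j ∈ Finset.range J, ((m + j).choose j : IterLaurent n) *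
        (if m + j < J then algebraMap ℂ (IterLaurent n) (s (m + j)) else 0) * iterVar i ^ j := by
  rw [letterPoly, map_sum]
  refine Finset.sum_congr rfl fun j _ => ?_
  rw [map_mul, map_pow, Polynomial.aeval_X, Polynomial.aeval_C, map_mul, map_natCast]
  split_ifs with h
  · rfl
  · rw [hs _ (not_lt.1 h), map_zero]

/-- In a nontrivial relation, the terms of largest total length would form a nonzero polynomial over
the field `ℂ((x₁))⋯((xₙ))`, and all complex jets would be zeros of it. -/
theorem eq_zero_of_sum_monomialSeries (hB : B.Nondegenerate) {n : ℕ}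
    (f : (Fin n → Multiset (I × ℕ)) →₀ IterLaurent n)
    (hf : (f.sum fun S c => c • monomialSeries B hs hi ℓ e S) = 0) : f = 0 := by
  classical
  by_contra hne
  obtain ⟨S₀, hS₀, hmax⟩ := f.support.exists_max_image (fun S => ∑ i, (S i).card)
    (Finsupp.support_nonempty_iff.2 hne)
  set d := ∑ i, (S₀ i).card with hd
  let P : MvPolynomial (Fin n × I × ℕ) (IterLaurent n) :=
    ∑ S ∈ f.support with ∑ i, (S i).card = d, MvPolynomial.monomial (multiExpo S) (f S)
  have hP : P = 0 := by
    refine mvPolynomial_eq_zero_of_jets iterVar (iterVar_injective n) P fun s J => ?_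
    -- Only finitely many basis vectors occur in the relation, and `exists_dual` prescribes letter
    -- values on finitely many of them.
    let A : Finset I := f.support.biUnion fun S =>
      Finset.univ.biUnion fun i => ((S i).map Prod.fst).toFinset
    obtain ⟨μ, hμ, hμ'⟩ := exists_dual B hs hi hB e e.linearIndependent A s J
    have hJ : ∀ a m, J ≤ m → letterValue B hs hi μ a m = 0 := fun a m hm => (hμ' m).1 hm a
    -- The coefficientwise symbol is linear over `ℂ((x₁))⋯((xₙ))`, so it maps the relation to the
    -- value of `P` at the jets of `s`.
    have h := congrArg (coeffwise (symbolAt B hs hi ℓ μ d)) hf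
    rw [map_zero, Finsupp.sum, map_sum] at h
    rw [map_sum, Finset.sum_filter]
    refine (Finset.sum_congr rfl fun S hS => ?_).trans h
    rw [map_smul, monomialSeries]
    split_ifs with hdS
    · have hlen : d = ∑ i, (letters e (S i)).length := by
        rw [← hdS]
        exact Finset.sum_congr rfl fun i _ => (length_letters e _).symm
      rw [hlen, coeffwise_symbolAt_iterY_word B hs hi ℓ μ hμ J hJ, eval_monomial_multiExpo,
        smul_eq_mul]
      congr 1
      refine Finset.prod_congr rfl fun i _ => ?_
      rw [prod_map_letters]
      refine congrArg Multiset.prod (Multiset.map_congr rfl fun c hc => ?_)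
      rw [aeval_letterPoly _ _ _ _ (hJ _)]
      refine Finset.sum_congr rfl fun j _ => ?_
      split_ifs with hj
      · rw [letterValue, (hμ' _).2 c.1 _ hj]
        refine Finset.mem_biUnion.2 ⟨S, hS, Finset.mem_biUnion.2 ⟨i, Finset.mem_univ i, ?_⟩⟩
        rw [Multiset.mem_toFinset]
        exact Multiset.mem_map_of_mem _ hc
      · rfl
    · rw [coeffwise_symbolAt_iterY_word_of_lt B hs hi ℓ μ hμ, smul_eq_mul, mul_zero]
      simp only [length_letters]
      exact lt_of_le_of_ne (hmax S hS) hdS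
  have h1 : MvPolynomial.coeff (multiExpo S₀) P = f S₀ :=
    coeff_sum_monomial_multiExpo _ f S₀ (Finset.mem_filter.2 ⟨hS₀, rfl⟩)
  rw [hP, MvPolynomial.coeff_zero] at h1
  exact Finsupp.mem_support_iff.1 hS₀ h1.symm

/-- A tensor in the kernel, written in spanning words with series as coefficients, is sent to a
relation between the `monomialSeries`; its coefficients are zero, hence so is the tensor. -/
theorem nondegenerate_affineVertexAlgebra (hB : B.Nondegenerate) :
    (affineVertexAlgebra B hs hi ℓ).Nondegenerate := by
  intro n _
  change Function.Injective (Z (affineY B hs hi ℓ) (vacuum B hs hi ℓ) n)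
  rw [injective_iff_map_eq_zero]
  intro t ht
  let e := Module.Basis.ofVectorSpace ℂ 𝔤
  obtain ⟨f, rfl⟩ := exists_sum_tprod_tmul _ (span_word_letters B hs hi ℓ e) t
  rw [Finsupp.sum, map_sum] at ht
  simp only [Z_tmul] at ht
  rw [eq_zero_of_sum_monomialSeries B hs hi ℓ e hB f ht, Finsupp.sum_zero_index]

end Independence

end

end AffineVA

theorem proposition3p18 {𝔤 : Type*} [LieRing 𝔤] [LieAlgebra ℂ 𝔤]
    (hdim : Module.rank ℂ 𝔤 ≤ Cardinal.aleph0)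
    (B : LinearMap.BilinForm ℂ 𝔤) (hsymm : B.IsSymm) (hinv : B.lieInvariant 𝔤)
    (hnondeg : B.Nondegenerate) (ℓ : ℂ) :
    (AffineVA.affineVertexAlgebra B hsymm hinv ℓ).Nondegenerate :=
  AffineVA.nondegenerate_affineVertexAlgebra B hsymm hinv ℓ hnondeg
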